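/- Let $d \in \mathbb{C}^\times$. Let $\mathcal{K}_d$ be the Temperley–Lieb category: the strict $\mathbb{C}$-linear monoidal category of planar tangles with objects $n = 0,1,2,\dots$ (tensor product: addition), i.e. the one generated by the object $X = 1$ and the arcs $\epsilon : X \otimes X \to I$, $\delta : I \to X \otimes X$ subject to $(\epsilon \otimes 1_X)(1_X \otimes \delta) = 1_X = (1_X \otimes \epsilon)(\delta \otimes 1_X)$ and $\epsilon\delta = d\,1_I$. A fiber functor is a $\mathbb{C}$-linear monoidal functor $F$ (with invertible structure maps $F(X^m)\otimes F(X^n) \cong F(X^{m+n})$ and $\mathbb{C} \cong F(I)$) from $\mathcal{K}_d$ to the category of finite-dimensional complex vector spaces; two fiber functors are isomorphic if there is a monoidal natural isomorphism between them. For an invertible matrix $E \in GL_N(\mathbb{C})$ put $\Theta(E) = E^{-1}\,{}^tE$. A multiplicity function assigns to each $z \in \mathbb{C}^\times$ a sequence $\mu(z) = (\mu^{(1)}(z), \mu^{(2)}(z), \dots)$ of non-negative integers, with $\mu^{(k)}(z) \neq 0$ for only finitely many pairs $(z,k)$; put $|\mu(z)| = \sum_{k\ge 1} k\,\mu^{(k)}(z)$.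 It is the multiplicity function of an invertible matrix $M$ if $M$ is similar to the block-diagonal Jordan matrix having, for all $z$ and $k$, exactly $\mu^{(k)}(z)$ Jordan blocks of size $k$ with eigenvalue $z$. **Theorem.** There is a one-to-one correspondence between isomorphism classes of fiber functors on $\mathcal{K}_d$ and multiplicity functions $\mu$ satisfying (i) $\mu(z) = \mu(z^{-1})$ for all $z \in \mathbb{C}^\times$, (ii) $\mu^{(k)}(1)$ is even for every even $k$, (iii) $\mu^{(k)}(-1)$ is even for every odd $k$, and $$d = \sum_{z \in \mathbb{C}^\times} |\mu(z)|\, z .$$ It is given as follows: for a fiber functor $F$ and any basis $b_1,\dots,b_N$ of $F(X)$, the matrix $E$ with entries $E_{ij} = F(\epsilon)(b_i \otimes b_j)$ (where $F(\epsilon)$ is regarded as a linear map $F(X)\otimes F(X) \to \mathbb{C}$ through the structure maps of $F$) is invertible, and the class of $F$ corresponds to the multiplicity function of $\Theta(E)$. -/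

import Mathlib

open CategoryTheory MonoidalCategory
open scoped TensorProduct

namespace TemperleyLieb

/-! ### The Temperley-Lieb category

Objects are the natural numbers (the number of boundary points).  A morphism `m ⟶ n` is a formal
`ℂ`-linear combination of planar tangles with `m` incoming and `n` outgoing boundary points, where
tangles are drawn from the elementary arcs `cap : 2 ⟶ 0` and `cup : 0 ⟶ 2` by stacking (`comp`)
and juxtaposition (`tensor`).  Tangles are taken up to planar isotopy (the axioms of a strict
monoidal category together with straightening of a zigzag) and a closed loop is the scalar `d`.
In other words it is the strict `ℂ`-linear monoidal category generated by one object and the two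
arcs, subject to the two zigzag relations and the loop relation. -/

/-- Formal linear combinations of tangles with `m` incoming and `n` outgoing boundary points. -/
inductive Term : ℕ → ℕ → Type
  | id (n : ℕ) : Term n n
  | comp {l m n : ℕ} (f : Term l m) (g : Term m n) : Term l n
  | tensor {m n m' n' : ℕ} (f : Term m n) (g : Term m' n') : Term (m + m') (n + n')
  | cap : Term 2 0
  | cup : Term 0 2
  | zero (m n : ℕ) : Term m n
  | add {m n : ℕ} (f g : Term m n) : Term m n
  | smul {m n : ℕ} (c : ℂ) (f : Term m n) : Term m n

/-- The identity, regarded as a morphism between two equal objects. -/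
def Term.eqTo {m n : ℕ} (h : m = n) : Term m n := h ▸ Term.id m

open Term in
/-- The congruence generated by the relations of the Temperley-Lieb category of parameter `d`. -/
inductive Rel (d : ℂ) : {m n : ℕ} → Term m n → Term m n → Prop
  -- equivalence relation, compatible with all operations
  | refl {m n : ℕ} (f : Term m n) : Rel d f f
  | symm {m n : ℕ} {f g : Term m n} : Rel d f g → Rel d g f
  | trans {m n : ℕ} {f g h : Term m n} : Rel d f g → Rel d g h → Rel d f h
  | comp_congr {l m n : ℕ} {f f' : Term l m} {g g' : Term m n} :
      Rel d f f' → Rel d g g' → Rel d (comp f g) (comp f' g')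
  | tensor_congr {m n m' n' : ℕ} {f f' : Term m n} {g g' : Term m' n'} :
      Rel d f f' → Rel d g g' → Rel d (tensor f g) (tensor f' g')
  | add_congr {m n : ℕ} {f f' g g' : Term m n} :
      Rel d f f' → Rel d g g' → Rel d (add f g) (add f' g')
  | smul_congr {m n : ℕ} (c : ℂ) {f f' : Term m n} :
      Rel d f f' → Rel d (smul c f) (smul c f')
  -- the morphisms between two objects form a complex vector space
  | add_assoc {m n : ℕ} (f g h : Term m n) : Rel d (add (add f g) h) (add f (add g h))
  | add_comm {m n : ℕ} (f g : Term m n) : Rel d (add f g) (add g f)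
  | zero_add {m n : ℕ} (f : Term m n) : Rel d (add (zero m n) f) f
  | zero_smul {m n : ℕ} (f : Term m n) : Rel d (smul 0 f) (zero m n)
  | one_smul {m n : ℕ} (f : Term m n) : Rel d (smul 1 f) f
  | mul_smul {m n : ℕ} (a b : ℂ) (f : Term m n) : Rel d (smul (a * b) f) (smul a (smul b f))
  | add_smul {m n : ℕ} (a b : ℂ) (f : Term m n) :
      Rel d (smul (a + b) f) (add (smul a f) (smul b f))
  | smul_add {m n : ℕ} (a : ℂ) (f g : Term m n) :
      Rel d (smul a (add f g)) (add (smul a f) (smul a g))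
  -- composition and juxtaposition are bilinear
  | add_comp {l m n : ℕ} (f f' : Term l m) (g : Term m n) :
      Rel d (comp (add f f') g) (add (comp f g) (comp f' g))
  | comp_add {l m n : ℕ} (f : Term l m) (g g' : Term m n) :
      Rel d (comp f (add g g')) (add (comp f g) (comp f g'))
  | smul_comp {l m n : ℕ} (c : ℂ) (f : Term l m) (g : Term m n) :
      Rel d (comp (smul c f) g) (smul c (comp f g))
  | comp_smul {l m n : ℕ} (c : ℂ) (f : Term l m) (g : Term m n) :
      Rel d (comp f (smul c g)) (smul c (comp f g))
  | add_tensor {m n m' n' : ℕ} (f f' : Term m n) (g : Term m' n') :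
      Rel d (tensor (add f f') g) (add (tensor f g) (tensor f' g))
  | tensor_add {m n m' n' : ℕ} (f : Term m n) (g g' : Term m' n') :
      Rel d (tensor f (add g g')) (add (tensor f g) (tensor f g'))
  | smul_tensor {m n m' n' : ℕ} (c : ℂ) (f : Term m n) (g : Term m' n') :
      Rel d (tensor (smul c f) g) (smul c (tensor f g))
  | tensor_smul {m n m' n' : ℕ} (c : ℂ) (f : Term m n) (g : Term m' n') :
      Rel d (tensor f (smul c g)) (smul c (tensor f g))
  -- the axioms of a category
  | id_comp {m n : ℕ} (f : Term m n) : Rel d (comp (id m) f) f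
  | comp_id {m n : ℕ} (f : Term m n) : Rel d (comp f (id n)) f
  | assoc {k l m n : ℕ} (f : Term k l) (g : Term l m) (h : Term m n) :
      Rel d (comp (comp f g) h) (comp f (comp g h))
  -- the axioms of a strict monoidal category
  | tensor_id (m n : ℕ) : Rel d (tensor (id m) (id n)) (id (m + n))
  | tensor_comp {l m n l' m' n' : ℕ} (f : Term l m) (g : Term m n) (f' : Term l' m')
      (g' : Term m' n') :
      Rel d (comp (tensor f f') (tensor g g')) (tensor (comp f g) (comp f' g'))
  | tensor_assoc {m n m' n' m'' n'' : ℕ} (f : Term m n) (g : Term m' n') (h : Term m'' n'') :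
      Rel d (comp (tensor (tensor f g) h) (eqTo (Nat.add_assoc n n' n'')))
        (comp (eqTo (Nat.add_assoc m m' m'')) (tensor f (tensor g h)))
  | id_zero_tensor {m n : ℕ} (f : Term m n) :
      Rel d (comp (tensor (id 0) f) (eqTo (Nat.zero_add n)))
        (comp (eqTo (Nat.zero_add m)) f)
  | tensor_id_zero {m n : ℕ} (f : Term m n) :
      Rel d (comp (tensor f (id 0)) (eqTo (Nat.add_zero n)))
        (comp (eqTo (Nat.add_zero m)) f)
  -- straightening a zigzag; both composites go `1 ⟶ 3 ⟶ 1`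
  | zigzag_left :
      Rel d (m := 1) (n := 1)
        (comp (m := 3) (tensor (m := 0) (n := 2) cup (id 1)) (tensor (n' := 0) (id 1) cap)) (id 1)
  | zigzag_right :
      Rel d (m := 1) (n := 1)
        (comp (m := 3) (tensor (m' := 0) (n' := 2) (id 1) cup) (tensor (n := 0) cap (id 1))) (id 1)
  -- a closed loop has value `d`
  | loop : Rel d (comp cup cap) (smul d (id 0))

/-- The Temperley-Lieb category of parameter `d`; its objects are the natural numbers. -/
def TL (_d : ℂ) : Type := ℕ

/-- Equality of formal combinations of tangles in the Temperley-Lieb category. -/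
def homSetoid (d : ℂ) (m n : ℕ) : Setoid (Term m n) where
  r := Rel d
  iseqv := ⟨Rel.refl, Rel.symm, Rel.trans⟩

/-- The space of morphisms from `m` to `n` in the Temperley-Lieb category. -/
def Hom (d : ℂ) (m n : ℕ) : Type := Quotient (homSetoid d m n)

namespace Hom

variable {d : ℂ}

/-- The morphism represented by a term. -/
def mk (d : ℂ) {m n : ℕ} (f : Term m n) : Hom d m n := Quotient.mk (homSetoid d m n) f

theorem sound {m n : ℕ} {f g : Term m n} (h : Rel d f g) : mk d f = mk d g :=
  Quotient.sound (s := homSetoid d m n) h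

theorem exists_rep {m n : ℕ} (x : Hom d m n) : ∃ f, mk d f = x :=
  Quotient.exists_rep x

/-- Composition (stacking). -/
def comp {l m n : ℕ} : Hom d l m → Hom d m n → Hom d l n :=
  Quotient.map₂ (sa := homSetoid d _ _) (sb := homSetoid d _ _) (sc := homSetoid d _ _) Term.comp
    fun _ _ h _ _ h' => Rel.comp_congr h h'

/-- Tensor product (juxtaposition). -/
def tensor {m n m' n' : ℕ} : Hom d m n → Hom d m' n' → Hom d (m + m') (n + n') :=
  Quotient.map₂ (sa := homSetoid d _ _) (sb := homSetoid d _ _) (sc := homSetoid d _ _) Term.tensor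
    fun _ _ h _ _ h' => Rel.tensor_congr h h'

instance {m n : ℕ} : Zero (Hom d m n) := ⟨mk d (Term.zero m n)⟩

instance {m n : ℕ} : Add (Hom d m n) :=
  ⟨Quotient.map₂ (sa := homSetoid d _ _) (sb := homSetoid d _ _) (sc := homSetoid d _ _) Term.add
    fun _ _ h _ _ h' => Rel.add_congr h h'⟩

instance {m n : ℕ} : SMul ℂ (Hom d m n) :=
  ⟨fun c => Quotient.map (sa := homSetoid d m n) (sb := homSetoid d m n) (Term.smul c)
    fun _ _ h => Rel.smul_congr c h⟩

instance {m n : ℕ} : Neg (Hom d m n) := ⟨fun f => (-1 : ℂ) • f⟩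

theorem zero_add' {m n : ℕ} (x : Hom d m n) : 0 + x = x := by
  obtain ⟨f, rfl⟩ := Hom.exists_rep x
  exact sound (Rel.zero_add f)

theorem add_comm' {m n : ℕ} (x y : Hom d m n) : x + y = y + x := by
  obtain ⟨f, rfl⟩ := Hom.exists_rep x
  obtain ⟨g, rfl⟩ := Hom.exists_rep y
  exact sound (Rel.add_comm f g)

theorem zero_smul' {m n : ℕ} (x : Hom d m n) : (0 : ℂ) • x = 0 := by
  obtain ⟨f, rfl⟩ := Hom.exists_rep x
  exact sound (Rel.zero_smul f)

theorem one_smul' {m n : ℕ} (x : Hom d m n) : (1 : ℂ) • x = x := by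
  obtain ⟨f, rfl⟩ := Hom.exists_rep x
  exact sound (Rel.one_smul f)

theorem mul_smul' {m n : ℕ} (a b : ℂ) (x : Hom d m n) : (a * b) • x = a • b • x := by
  obtain ⟨f, rfl⟩ := Hom.exists_rep x
  exact sound (Rel.mul_smul a b f)

theorem add_smul' {m n : ℕ} (a b : ℂ) (x : Hom d m n) : (a + b) • x = a • x + b • x := by
  obtain ⟨f, rfl⟩ := Hom.exists_rep x
  exact sound (Rel.add_smul a b f)

instance {m n : ℕ} : AddCommGroup (Hom d m n) where
  add_assoc x y z := by
    obtain ⟨f, rfl⟩ := Hom.exists_rep x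
    obtain ⟨g, rfl⟩ := Hom.exists_rep y
    obtain ⟨h, rfl⟩ := Hom.exists_rep z
    exact sound (Rel.add_assoc f g h)
  zero_add := zero_add'
  add_zero x := by rw [add_comm', zero_add']
  nsmul := nsmulRec
  zsmul := zsmulRec
  add_comm := add_comm'
  neg_add_cancel x := by
    change (-1 : ℂ) • x + x = 0
    conv_lhs => rw [← one_smul' x, ← mul_smul', ← add_smul']
    simpa using zero_smul' x

instance {m n : ℕ} : Module ℂ (Hom d m n) where
  one_smul := one_smul'
  mul_smul := mul_smul'
  add_smul := add_smul'
  zero_smul := zero_smul'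
  smul_zero c := by rw [← zero_smul' (0 : Hom d m n), ← mul_smul', mul_zero]
  smul_add c x y := by
    obtain ⟨f, rfl⟩ := Hom.exists_rep x
    obtain ⟨g, rfl⟩ := Hom.exists_rep y
    exact sound (Rel.smul_add c f g)

end Hom

instance (d : ℂ) : Category (TL d) where
  Hom m n := Hom d m n
  id n := Hom.mk d (Term.id n)
  comp f g := Hom.comp f g
  id_comp f := by
    obtain ⟨f, rfl⟩ := Hom.exists_rep f
    exact Hom.sound (Rel.id_comp f)
  comp_id f := by
    obtain ⟨f, rfl⟩ := Hom.exists_rep f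
    exact Hom.sound (Rel.comp_id f)
  assoc f g h := by
    obtain ⟨f, rfl⟩ := Hom.exists_rep f
    obtain ⟨g, rfl⟩ := Hom.exists_rep g
    obtain ⟨h, rfl⟩ := Hom.exists_rep h
    exact Hom.sound (Rel.assoc f g h)

instance (d : ℂ) : Preadditive (TL d) where
  homGroup := fun (m n : ℕ) => inferInstanceAs (AddCommGroup (Hom d m n))
  add_comp _ _ _ f f' g := by
    obtain ⟨f, rfl⟩ := Hom.exists_rep f
    obtain ⟨f', rfl⟩ := Hom.exists_rep f'
    obtain ⟨g, rfl⟩ := Hom.exists_rep g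
    exact Hom.sound (Rel.add_comp f f' g)
  comp_add _ _ _ f g g' := by
    obtain ⟨f, rfl⟩ := Hom.exists_rep f
    obtain ⟨g, rfl⟩ := Hom.exists_rep g
    obtain ⟨g', rfl⟩ := Hom.exists_rep g'
    exact Hom.sound (Rel.comp_add f g g')

instance (d : ℂ) : Linear ℂ (TL d) where
  homModule := fun (m n : ℕ) => inferInstanceAs (Module ℂ (Hom d m n))
  smul_comp _ _ _ c f g := by
    obtain ⟨f, rfl⟩ := Hom.exists_rep f
    obtain ⟨g, rfl⟩ := Hom.exists_rep g
    exact Hom.sound (Rel.smul_comp c f g)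
  comp_smul _ _ _ f c g := by
    obtain ⟨f, rfl⟩ := Hom.exists_rep f
    obtain ⟨g, rfl⟩ := Hom.exists_rep g
    exact Hom.sound (Rel.comp_smul c f g)

/-- The tensor product is addition of natural numbers; the structure is strict. -/
instance (d : ℂ) : MonoidalCategoryStruct (TL d) where
  tensorObj := fun (m n : ℕ) => (m + n : ℕ)
  tensorUnit := (0 : ℕ)
  tensorHom f g := Hom.tensor f g
  whiskerLeft m _ _ f := Hom.tensor (Hom.mk d (Term.id m)) f
  whiskerRight f n := Hom.tensor f (Hom.mk d (Term.id n))
  associator := fun (l m n : ℕ) => eqToIso (C := TL d) (Nat.add_assoc l m n)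
  leftUnitor := fun (n : ℕ) => eqToIso (C := TL d) (Nat.zero_add n)
  rightUnitor := fun (n : ℕ) => eqToIso (C := TL d) (Nat.add_zero n)

theorem eqToHom_eq (d : ℂ) {m n : ℕ} (h : m = n) :
    eqToHom (C := TL d) h = Hom.mk d (Term.eqTo h) := by
  subst h; rfl

theorem comp_eqTo (d : ℂ) {l m n : ℕ} (h : l = m) (h' : m = n) :
    Hom.comp (Hom.mk d (Term.eqTo h)) (Hom.mk d (Term.eqTo h')) =
      Hom.mk d (Term.eqTo (h.trans h')) := by
  subst h h'; exact Hom.sound (Rel.id_comp _)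

theorem tensor_eqTo (d : ℂ) {m n m' n' : ℕ} (h : m = n) (h' : m' = n') :
    Hom.tensor (Hom.mk d (Term.eqTo h)) (Hom.mk d (Term.eqTo h')) =
      Hom.mk d (Term.eqTo (congrArg₂ (fun a b : ℕ => a + b) h h')) := by
  subst h h'; exact Hom.sound (Rel.tensor_id _ _)

theorem associator_hom (d : ℂ) (l m n : ℕ) :
    (associator (C := TL d) l m n).hom = Hom.mk d (Term.eqTo (Nat.add_assoc l m n)) :=
  eqToHom_eq d _

theorem leftUnitor_hom (d : ℂ) (n : ℕ) :
    (leftUnitor (C := TL d) n).hom = Hom.mk d (Term.eqTo (Nat.zero_add n)) :=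
  eqToHom_eq d _

theorem rightUnitor_hom (d : ℂ) (n : ℕ) :
    (rightUnitor (C := TL d) n).hom = Hom.mk d (Term.eqTo (Nat.add_zero n)) :=
  eqToHom_eq d (Nat.add_zero n)

instance (d : ℂ) : MonoidalCategory (TL d) :=
  MonoidalCategory.ofTensorHom
    (id_tensorHom_id := fun _ _ => Hom.sound (Rel.tensor_id _ _))
    (id_tensorHom := fun _ _ _ _ => rfl)
    (tensorHom_id := fun _ _ => rfl)
    (tensorHom_comp_tensorHom := fun f f' g g' => by
      obtain ⟨f, rfl⟩ := Hom.exists_rep f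
      obtain ⟨f', rfl⟩ := Hom.exists_rep f'
      obtain ⟨g, rfl⟩ := Hom.exists_rep g
      obtain ⟨g', rfl⟩ := Hom.exists_rep g'
      exact Hom.sound (Rel.tensor_comp f g f' g'))
    (associator_naturality := fun f g h => by
      obtain ⟨f, rfl⟩ := Hom.exists_rep f
      obtain ⟨g, rfl⟩ := Hom.exists_rep g
      obtain ⟨h, rfl⟩ := Hom.exists_rep h
      erw [associator_hom, associator_hom]
      exact Hom.sound (Rel.tensor_assoc f g h))
    (leftUnitor_naturality := fun f => by
      obtain ⟨f, rfl⟩ := Hom.exists_rep f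
      erw [leftUnitor_hom, leftUnitor_hom]
      exact Hom.sound (Rel.id_zero_tensor f))
    (rightUnitor_naturality := fun f => by
      obtain ⟨f, rfl⟩ := Hom.exists_rep f
      erw [rightUnitor_hom, rightUnitor_hom]
      exact Hom.sound (Rel.tensor_id_zero f))
    (pentagon := fun (k l m n : ℕ) => by
      erw [associator_hom, associator_hom, associator_hom, associator_hom, associator_hom]
      have h1 := tensor_eqTo d (Nat.add_assoc k l m) (Eq.refl n)
      have h2 := tensor_eqTo d (Eq.refl k) (Nat.add_assoc l m n)
      exact (congrArg₂ (fun x y => Hom.comp x (Hom.comp _ y)) h1 h2).trans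
        ((congrArg _ (comp_eqTo d _ _)).trans
          ((comp_eqTo d _ _).trans (comp_eqTo d _ _).symm)))
    (triangle := fun (m n : ℕ) => by
      erw [associator_hom, leftUnitor_hom, rightUnitor_hom]
      have h1 := tensor_eqTo d (Nat.add_zero m) (Eq.refl n)
      have h2 := tensor_eqTo d (Eq.refl m) (Nat.zero_add n)
      exact (congrArg _ h2).trans ((comp_eqTo d _ _).trans h1.symm))

theorem whiskerLeft_add' {d : ℂ} {l m n : TL d} (f g : m ⟶ n) :
    l ◁ (f + g) = l ◁ f + l ◁ g := by
  obtain ⟨f, rfl⟩ := Hom.exists_rep f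
  obtain ⟨g, rfl⟩ := Hom.exists_rep g
  exact Hom.sound (Rel.tensor_add _ f g)

theorem add_whiskerRight' {d : ℂ} {l m n : TL d} (f g : m ⟶ n) :
    (f + g) ▷ l = f ▷ l + g ▷ l := by
  obtain ⟨f, rfl⟩ := Hom.exists_rep f
  obtain ⟨g, rfl⟩ := Hom.exists_rep g
  exact Hom.sound (Rel.add_tensor f g _)

instance (d : ℂ) : MonoidalPreadditive (TL d) where
  whiskerLeft_zero {l m n} := by
    have h := whiskerLeft_add' (l := l) (0 : m ⟶ n) 0
    rwa [add_zero, left_eq_add] at h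
  zero_whiskerRight {l m n} := by
    have h := add_whiskerRight' (l := l) (0 : m ⟶ n) 0
    rwa [add_zero, left_eq_add] at h
  whiskerLeft_add := whiskerLeft_add'
  add_whiskerRight := add_whiskerRight'

instance (d : ℂ) : MonoidalLinear ℂ (TL d) where
  whiskerLeft_smul _ _ _ c f := by
    obtain ⟨f, rfl⟩ := Hom.exists_rep f
    exact Hom.sound (Rel.tensor_smul c _ f)
  smul_whiskerRight c _ _ f _ := by
    obtain ⟨f, rfl⟩ := Hom.exists_rep f
    exact Hom.sound (Rel.smul_tensor c f _)

/-- The generating object. -/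
def TL.X (d : ℂ) : TL d := (1 : ℕ)

/-- The arc `ε : X ⊗ X ⟶ I`. -/
def TL.ε (d : ℂ) : TL.X d ⊗ TL.X d ⟶ 𝟙_ (TL d) := Hom.mk d Term.cap

/-! ### Fiber functors -/

/-- A fiber functor: a `ℂ`-linear (strong) monoidal functor from the Temperley-Lieb category to
finite-dimensional complex vector spaces. -/
structure FiberFunctor (d : ℂ) where
  /-- the underlying functor -/
  F : TL d ⥤ FGModuleCat.{0} ℂ
  [additive : F.Additive]
  [linear : F.Linear ℂ]
  /-- the isomorphisms `F m ⊗ F n ≅ F (m + n)` and `ℂ ≅ F 0` -/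
  [monoidal : F.Monoidal]

namespace FiberFunctor

attribute [instance] additive linear monoidal

/-- Monoidal equivalence of fiber functors: existence of a monoidal natural isomorphism. -/
instance setoid (d : ℂ) : Setoid (FiberFunctor d) where
  r F G := ∃ t : F.F ≅ G.F, NatTrans.IsMonoidal t.hom
  iseqv :=
    { refl := fun F => ⟨Iso.refl F.F, inferInstanceAs (NatTrans.IsMonoidal (𝟙 F.F))⟩
      symm := fun ⟨t, _⟩ => ⟨t.symm, inferInstanceAs (NatTrans.IsMonoidal t.inv)⟩
      trans := fun ⟨t, _⟩ ⟨s, _⟩ =>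
        ⟨t ≪≫ s, inferInstanceAs (NatTrans.IsMonoidal (t.hom ≫ s.hom))⟩ }

/-- Isomorphism classes of fiber functors. -/
def IsoClass (d : ℂ) : Type 1 := Quotient (setoid d)

/-- The isomorphism class of a fiber functor. -/
def isoClass {d : ℂ} (F : FiberFunctor d) : IsoClass d := Quotient.mk (setoid d) F

variable {d : ℂ} (F : FiberFunctor d)

/-- The vector space `F(X)`. -/
abbrev V : FGModuleCat.{0} ℂ := F.F.obj (TL.X d)

/-- The bilinear form `F(ε) : F(X) ⊗ F(X) ≅ F(X ⊗ X) ⟶ F(I) ≅ ℂ`. -/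
noncomputable def form : F.V ⊗[ℂ] F.V →ₗ[ℂ] ℂ :=
  (Functor.LaxMonoidal.μ F.F (TL.X d) (TL.X d) ≫ F.F.map (TL.ε d) ≫
    Functor.OplaxMonoidal.η F.F).hom.hom

/-- The matrix `E` of the bilinear form of `F` in a basis of `F(X)`. -/
noncomputable def formMatrix {N : ℕ} (b : Module.Basis (Fin N) ℂ F.V) :
    Matrix (Fin N) (Fin N) ℂ :=
  Matrix.of fun i j => F.form (b i ⊗ₜ[ℂ] b j)

end FiberFunctor

/-! ### Jordan multiplicities -/

/-- The matrix `Θ(E) = E⁻¹ ᵗE` (for invertible `E`). -/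
noncomputable def Θ {N : ℕ} (E : Matrix (Fin N) (Fin N) ℂ) : Matrix (Fin N) (Fin N) ℂ :=
  E⁻¹ * E.transpose

/-- The Jordan block of size `k` with eigenvalue `z`. -/
def jordanBlock (k : ℕ) (z : ℂ) : Matrix (Fin k) (Fin k) ℂ :=
  Matrix.of fun i j => if i = j then z else if (i : ℕ) + 1 = j then 1 else 0

/-- A multiplicity function on `ℂ^×`: `μ z k` is the multiplicity of Jordan blocks of size `k`
with eigenvalue `z`, zero for all but finitely many pairs `(z, k)`. -/
abbrev MultiplicityFunction : Type := ℂˣ →₀ ℕ+ →₀ ℕ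

namespace MultiplicityFunction

variable (μ : MultiplicityFunction)

/-- The individual Jordan blocks prescribed by `μ`: `μ z k` of them for each `z` and `k`. -/
abbrev Block : Type := (z : μ.support) × (k : (μ z).support) × Fin (μ z k)

/-- The row (and column) indices of the Jordan matrix prescribed by `μ`. -/
abbrev Index : Type := (a : μ.Block) × Fin (a.2.1 : ℕ+)

/-- The block diagonal Jordan matrix with exactly `μ z k` blocks of size `k` with eigenvalue
`z`. -/
noncomputable def jordanMatrix : Matrix μ.Index μ.Index ℂ :=
  Matrix.blockDiagonal' fun a : μ.Block => jordanBlock (a.2.1 : ℕ+) (a.1 : ℂˣ)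

/-- `μ` is the multiplicity function of the matrix `M`: in a suitable basis, `M` becomes the
Jordan matrix prescribed by `μ`. -/
def IsMultiplicityOf {N : ℕ} (M : Matrix (Fin N) (Fin N) ℂ) : Prop :=
  ∃ c : Module.Basis μ.Index ℂ (Fin N → ℂ),
    LinearMap.toMatrix c c (Matrix.toLin' M) = μ.jordanMatrix

/-- The three symmetry and parity conditions. -/
structure IsAdmissible : Prop where
  symm : ∀ z : ℂˣ, μ z = μ z⁻¹
  even_one : ∀ k : ℕ+, Even (k : ℕ) → Even (μ 1 k)
  even_neg_one : ∀ k : ℕ+, Odd (k : ℕ) → Even (μ (-1) k)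

/-- The total multiplicity `|μ(z)| = ∑ₖ k μ⁽ᵏ⁾(z)`. -/
def total (z : ℂˣ) : ℕ := (μ z).sum fun k m => (k : ℕ) * m

/-- The number `∑_z |μ(z)| z`. -/
noncomputable def trace : ℂ := ∑ z ∈ μ.support, (μ.total z : ℂ) * (z : ℂ)

end MultiplicityFunction

end TemperleyLieb

/-!
A fiber functor `F` is determined by the bilinear space `F(X)` with the form `F(ε)`.  The zigzag
relations say that `F(δ)` is the inverse of the matrix `E` of the form, so `E` is invertible and an
isometry `F(X) ≃ G(X)` respects the images of both arcs; since the arcs generate the category, its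
tensor powers form a monoidal natural isomorphism (`FiberFunctor.equiv_of_isometry`).  The loop
relation becomes `tr (E⁻¹ * ᵗE) = d`.  Conversely, any invertible `E` with this trace defines a
fiber functor, by letting tangles act on tensor powers of `ℂ^ι` (`FiberFunctor.exists_gram_eq`).
Thus isomorphism classes of fiber functors correspond to congruence classes of such matrices `E`.

Over `ℂ`, the congruence class of `E` is determined by the similarity class of its asymmetry
`Θ(E) = E⁻¹ * ᵗE` (`exists_congruence_of_theta_similar`).  After a change of basis, two matrices
`E` and `E'` with similar asymmetries have equal ones; then `A = E⁻¹ * E'` is self-adjoint for `E`,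
and a square root of `A` that is a polynomial in `A` is a congruence from `E` to `E'`.

It remains to see which multiplicity functions come from asymmetries.  Jordan multiplicities are,
up to sign, second differences of the dimensions of the kernels of `(M - z) ^ j`, so that all
statements about them can be read off from ranks.  For `T = Θ(E)` the identity `ᵗT * E * T = E`
matches the ranks at `z` and `z⁻¹`, and for `z = ±1` the matrix `(T - z) ^ (2 * m) * (T - 1)` has the
rank of a skew-symmetric one, which is even; this gives the parity conditions
(`isAdmissible_of_isMultiplicityOf`).  Conversely, an admissible multiplicity function is a sum of
pairs of blocks with inverse eigenvalues and of single blocks of size `k` with eigenvalue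
`(-1) ^ (k - 1)`, each of which is the asymmetry of an explicit form
(`MultiplicityFunction.IsAdmissible.realizable`).
-/

namespace TemperleyLieb

/-! ### The fiber functor attached to an invertible matrix -/

section Model

variable {ι : Type} [Fintype ι] [DecidableEq ι]

/-- The matrix of a tangle in the tensor model attached to `E`: rows and columns are indexed by
words in `ι` labelling the incoming and outgoing boundary points, and matrices act on row vectors,
so that stacking tangles in diagrammatic order is multiplication in the same order.  A cap carries
the entries of `E` and a cup those of `E⁻¹`. -/
noncomputable def Term.eval (E : Matrix ι ι ℂ) :
    {m n : ℕ} → Term m n → Matrix (Fin m → ι) (Fin n → ι) ℂ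
  | _, _, .id _ => 1
  | _, _, .comp f g => f.eval E * g.eval E
  | _, _, .tensor f g => Matrix.of fun u v =>
      f.eval E (fun i => u (Fin.castAdd _ i)) (fun i => v (Fin.castAdd _ i)) *
        g.eval E (fun i => u (Fin.natAdd _ i)) (fun i => v (Fin.natAdd _ i))
  | _, _, .cap => Matrix.of fun u _ => E (u 0) (u 1)
  | _, _, .cup => Matrix.of fun _ v => E⁻¹ (v 0) (v 1)
  | _, _, .zero _ _ => 0
  | _, _, .add f g => f.eval E + g.eval E
  | _, _, .smul c f => c • f.eval E

omit [DecidableEq ι] in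
theorem sum_split {m n : ℕ} {R : Type*} [AddCommMonoid R] (f : (Fin m → ι) → (Fin n → ι) → R) :
    ∑ w : Fin (m + n) → ι, f (fun i => w (Fin.castAdd n i)) (fun i => w (Fin.natAdd m i)) =
      ∑ u, ∑ v, f u v := by
  rw [← Fintype.sum_prod_type', ← (Fin.appendEquiv m n).sum_comp]
  simp [Fin.appendEquiv]

omit [DecidableEq ι] in
theorem sum_cons {n : ℕ} {R : Type*} [AddCommMonoid R] (f : (Fin (n + 1) → ι) → R) :
    ∑ w, f w = ∑ i, ∑ w, f (Fin.cons i w) := by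
  rw [← (Fin.consEquiv fun _ : Fin (n + 1) => ι).sum_comp, Fintype.sum_prod_type]
  rfl

omit [DecidableEq ι] in
theorem sum_fin_zero {R : Type*} [AddCommMonoid R] (f : (Fin 0 → ι) → R) :
    ∑ w, f w = f Fin.elim0 := by
  rw [Fintype.sum_unique]
  congr 1

omit [Fintype ι] in
theorem one_apply_fin_one (u v : Fin 1 → ι) :
    (1 : Matrix (Fin 1 → ι) (Fin 1 → ι) ℂ) u v = if u 0 = v 0 then 1 else 0 := by
  rw [Matrix.one_apply]
  congr 1
  simp [funext_iff]

variable (E : Matrix ι ι ℂ)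

theorem Term.mul_eval_eqTo {l m n : ℕ} (h : m = n) (M : Matrix (Fin l → ι) (Fin m → ι) ℂ) (u v) :
    (M * (Term.eqTo h).eval E) u v = M u (fun i => v (Fin.cast h i)) := by
  subst h
  simp [Term.eqTo, Term.eval]

theorem Term.eval_eqTo_mul {l m n : ℕ} (h : m = n) (M : Matrix (Fin n → ι) (Fin l → ι) ℂ) (u v) :
    ((Term.eqTo h).eval E * M) u v = M (fun i => u (Fin.cast h.symm i)) v := by
  subst h
  simp [Term.eqTo, Term.eval]

/-- All relations of the Temperley-Lieb category hold in the tensor model: the zigzags because the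
cup is the inverse matrix of the cap, and the loop by the choice of `d`. -/
theorem Rel.eval_eq {d : ℂ} (hE : IsUnit E) (hd : ∑ i, ∑ j, E i j * E⁻¹ i j = d)
    {m n : ℕ} {f g : Term m n} (h : Rel d f g) : f.eval E = g.eval E := by
  induction h with
  | refl f => rfl
  | symm _ ih => exact ih.symm
  | trans _ _ ih ih' => exact ih.trans ih'
  | comp_congr _ _ ih ih' => simp only [Term.eval, ih, ih']
  | tensor_congr _ _ ih ih' => simp only [Term.eval, ih, ih']
  | add_congr _ _ ih ih' => simp only [Term.eval, ih, ih']
  | smul_congr c _ ih => simp only [Term.eval, ih]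
  | add_assoc f g h => simp only [Term.eval, _root_.add_assoc]
  | add_comm f g => simp only [Term.eval, _root_.add_comm]
  | zero_add f => simp only [Term.eval, _root_.zero_add]
  | zero_smul f => simp only [Term.eval, _root_.zero_smul]
  | one_smul f => simp only [Term.eval, _root_.one_smul]
  | mul_smul a b f => simp only [Term.eval, SemigroupAction.mul_smul]
  | add_smul a b f => simp only [Term.eval, _root_.add_smul]
  | smul_add a f g => simp only [Term.eval, _root_.smul_add]
  | add_comp f f' g => simp only [Term.eval, Matrix.add_mul]
  | comp_add f g g' => simp only [Term.eval, Matrix.mul_add]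
  | smul_comp c f g => simp only [Term.eval, Matrix.smul_mul]
  | comp_smul c f g => simp only [Term.eval, Matrix.mul_smul]
  | add_tensor f f' g => ext u v; simp [Term.eval, add_mul]
  | tensor_add f g g' => ext u v; simp [Term.eval, mul_add]
  | smul_tensor c f g => ext u v; simp [Term.eval, mul_assoc]
  | tensor_smul c f g => ext u v; simp [Term.eval, mul_left_comm]
  | id_comp f => simp [Term.eval]
  | comp_id f => simp [Term.eval]
  | assoc f g h => simp only [Term.eval, Matrix.mul_assoc]
  | tensor_id m n =>
    ext u v
    simp only [Term.eval, Matrix.of_apply, Matrix.one_apply]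
    rw [ite_zero_mul_ite_zero, mul_one]
    congr 1
    rw [eq_iff_iff, ← (Fin.appendEquiv m n).symm.injective.eq_iff, Prod.ext_iff]
    rfl
  | tensor_comp f g f' g' =>
    ext u v
    simp only [Term.eval, Matrix.mul_apply, Matrix.of_apply]
    rw [Finset.sum_mul_sum, ← sum_split]
    exact Finset.sum_congr rfl fun _ _ => by ring
  | tensor_assoc f g h =>
    ext u v
    simp only [Term.eval, Term.mul_eval_eqTo, Term.eval_eqTo_mul]
    simp only [Matrix.of_apply, _root_.mul_assoc]
    refine congrArg₂ (· * ·) ?_ (congrArg₂ (· * ·) ?_ ?_) <;>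
      refine congrArg₂ (Term.eval E _) ?_ ?_ <;> funext i <;>
      first
      | exact congrArg u (Fin.ext (by simp [Nat.add_assoc]))
      | exact congrArg v (Fin.ext (by simp [Nat.add_assoc]))
  | id_zero_tensor f =>
    ext u v
    simp only [Term.eval, Term.mul_eval_eqTo, Term.eval_eqTo_mul]
    rw [Matrix.of_apply, Matrix.one_apply, if_pos (Subsingleton.elim _ _), one_mul]
    refine congrArg₂ (Term.eval E _) ?_ ?_ <;> funext i
    · exact congrArg u (Fin.ext (by simp))
    · exact congrArg v (Fin.ext (by simp))
  | tensor_id_zero f =>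
    ext u v
    simp only [Term.eval, Term.mul_eval_eqTo, Term.eval_eqTo_mul]
    rw [Matrix.of_apply, Matrix.one_apply, if_pos (Subsingleton.elim _ _), mul_one]
    rfl
  | zigzag_left =>
    have h : E⁻¹ * E = 1 := Matrix.nonsing_inv_mul _ ((Matrix.isUnit_iff_isUnit_det _).1 hE)
    ext u v
    have h := congrFun₂ h (v 0) (u 0)
    simp only [Term.eval, Matrix.mul_apply, Matrix.of_apply]
    rw [sum_cons]
    simp only [sum_cons, sum_fin_zero, one_apply_fin_one]
    change ∑ x, ∑ y, ∑ z, (E⁻¹ x y * if u 0 = z then 1 else 0) *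
      ((if x = v 0 then 1 else 0) * E y z) = _
    simpa [Matrix.mul_apply, Matrix.one_apply, eq_comm] using h
  | zigzag_right =>
    have h : E * E⁻¹ = 1 := Matrix.mul_nonsing_inv _ ((Matrix.isUnit_iff_isUnit_det _).1 hE)
    ext u v
    have h := congrFun₂ h (u 0) (v 0)
    simp only [Term.eval, Matrix.mul_apply, Matrix.of_apply]
    rw [sum_cons]
    simp only [sum_cons, sum_fin_zero, one_apply_fin_one]
    change ∑ x, ∑ y, ∑ z, ((if u 0 = x then 1 else 0) * E⁻¹ y z) *
      (E x y * (if z = v 0 then 1 else 0)) = _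
    simpa [Matrix.mul_apply, Matrix.one_apply, eq_comm, mul_comm] using h
  | loop =>
    ext u v
    simp only [Term.eval, Matrix.mul_apply, Matrix.of_apply]
    simp only [sum_cons, sum_fin_zero]
    change ∑ x, ∑ y, E⁻¹ x y * E x y = _
    simp [← hd, Subsingleton.elim u v, mul_comm]

variable {E} {d : ℂ} (hE : IsUnit E) (hd : ∑ i, ∑ j, E i j * E⁻¹ i j = d)

/-- The matrix of a morphism in the tensor model. -/
noncomputable def Hom.eval {m n : ℕ} : Hom d m n → Matrix (Fin m → ι) (Fin n → ι) ℂ :=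
  Quotient.lift (s := homSetoid d m n) (Term.eval E) fun _ _ h => Rel.eval_eq E hE hd h

/-- The linear map of a morphism in the tensor model, on tensors written in coordinates. -/
noncomputable def Hom.evalLin {m n : ℕ} (f : Hom d m n) :
    ((Fin m → ι) → ℂ) →ₗ[ℂ] ((Fin n → ι) → ℂ) :=
  Matrix.vecMulLinear (Hom.eval hE hd f)

theorem Hom.evalLin_id (n : ℕ) : Hom.evalLin hE hd (Hom.mk d (Term.id n)) = LinearMap.id :=
  LinearMap.ext fun x => Matrix.vecMul_one x

theorem Hom.evalLin_comp {l m n : ℕ} (f : Hom d l m) (g : Hom d m n) :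
    Hom.evalLin hE hd (Hom.comp f g) = Hom.evalLin hE hd g ∘ₗ Hom.evalLin hE hd f := by
  obtain ⟨f, rfl⟩ := Hom.exists_rep f
  obtain ⟨g, rfl⟩ := Hom.exists_rep g
  exact LinearMap.ext fun x => (Matrix.vecMul_vecMul x _ _).symm

theorem Hom.evalLin_add {m n : ℕ} (f g : Hom d m n) :
    Hom.evalLin hE hd (f + g) = Hom.evalLin hE hd f + Hom.evalLin hE hd g := by
  obtain ⟨f, rfl⟩ := Hom.exists_rep f
  obtain ⟨g, rfl⟩ := Hom.exists_rep g
  exact LinearMap.ext fun x => Matrix.vecMul_add _ _ x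

theorem Hom.evalLin_smul {m n : ℕ} (c : ℂ) (f : Hom d m n) :
    Hom.evalLin hE hd (c • f) = c • Hom.evalLin hE hd f := by
  obtain ⟨f, rfl⟩ := Hom.exists_rep f
  exact LinearMap.ext fun x => Matrix.vecMul_smul x _ _

theorem Hom.evalLin_eqTo {m n : ℕ} (h : m = n) (x : (Fin m → ι) → ℂ) (w) :
    Hom.evalLin hE hd (Hom.mk d (Term.eqTo h)) x w = x (fun i => w (Fin.cast h i)) := by
  subst h
  exact congrFun (LinearMap.congr_fun (Hom.evalLin_id hE hd m) x) w

/-- The isomorphism `(ℂ^ι)^{⊗ m} ⊗ (ℂ^ι)^{⊗ n} ≃ (ℂ^ι)^{⊗ (m + n)}` in coordinates, induced by the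
concatenation of words. -/
noncomputable def wordTensorEquiv (ι : Type) [Fintype ι] (m n : ℕ) :
    ((Fin m → ι) → ℂ) ⊗[ℂ] ((Fin n → ι) → ℂ) ≃ₗ[ℂ] ((Fin (m + n) → ι) → ℂ) :=
  ((Pi.basisFun ℂ _).tensorProduct (Pi.basisFun ℂ _)).equiv (Pi.basisFun ℂ _) (Fin.appendEquiv m n)

omit [DecidableEq ι] in
theorem wordTensorEquiv_tmul {m n : ℕ} (x : (Fin m → ι) → ℂ) (y : (Fin n → ι) → ℂ) (w) :
    wordTensorEquiv ι m n (x ⊗ₜ y) w =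
      x (fun i => w (Fin.castAdd n i)) * y (fun i => w (Fin.natAdd m i)) := by
  change ((Pi.basisFun ℂ (Fin m → ι)).tensorProduct (Pi.basisFun ℂ (Fin n → ι))).repr (x ⊗ₜ y)
    ((Fin.appendEquiv m n).symm w) = _
  rw [Module.Basis.tensorProduct_repr_tmul_apply]
  simp [mul_comm]

theorem Hom.wordTensorEquiv_evalLin {m n m' n' : ℕ} (x : (Fin m → ι) → ℂ) (y : (Fin m' → ι) → ℂ)
    (f : Hom d m n) (g : Hom d m' n') :
    wordTensorEquiv ι n n' (Hom.evalLin hE hd f x ⊗ₜ Hom.evalLin hE hd g y) =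
      Hom.evalLin hE hd (Hom.tensor f g) (wordTensorEquiv ι m m' (x ⊗ₜ y)) := by
  obtain ⟨f, rfl⟩ := Hom.exists_rep f
  obtain ⟨g, rfl⟩ := Hom.exists_rep g
  ext w
  rw [wordTensorEquiv_tmul]
  change Matrix.vecMul x (f.eval E) _ * Matrix.vecMul y (g.eval E) _ =
    Matrix.vecMul _ ((f.tensor g).eval E) _
  simp only [Matrix.vecMul, dotProduct, Term.eval, wordTensorEquiv_tmul, Matrix.of_apply]
  rw [Finset.sum_mul_sum, ← sum_split]
  exact Finset.sum_congr rfl fun _ _ => by ring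

theorem Hom.wordTensorEquiv_assoc {l m n : ℕ} (x : (Fin l → ι) → ℂ) (y : (Fin m → ι) → ℂ)
    (z : (Fin n → ι) → ℂ) :
    Hom.evalLin hE hd (Hom.mk d (Term.eqTo (Nat.add_assoc l m n)))
        (wordTensorEquiv ι (l + m) n (wordTensorEquiv ι l m (x ⊗ₜ y) ⊗ₜ z)) =
      wordTensorEquiv ι l (m + n) (x ⊗ₜ wordTensorEquiv ι m n (y ⊗ₜ z)) := by
  ext w
  simp only [Hom.evalLin_eqTo, wordTensorEquiv_tmul, mul_assoc]
  refine congrArg₂ (· * ·) rfl (congrArg₂ (· * ·) rfl ?_)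
  refine congrArg z (funext fun i => congrArg w (Fin.ext ?_))
  simp [Nat.add_assoc]

/-- `Hom.evalLin` as a morphism of finite-dimensional spaces. -/
noncomputable def Hom.toFGModuleCat {m n : ℕ} (f : Hom d m n) :
    FGModuleCat.of ℂ ((Fin m → ι) → ℂ) ⟶ FGModuleCat.of ℂ ((Fin n → ι) → ℂ) :=
  FGModuleCat.ofHom (Hom.evalLin hE hd f)

/-- The functor `n ↦ (ℂ^ι)^{⊗ n}`, with `(ℂ^ι)^{⊗ n}` realized as the functions on words of length
`n` in `ι`. -/
noncomputable def modelFunctor : TL d ⥤ FGModuleCat.{0} ℂ where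
  obj := fun (n : ℕ) => FGModuleCat.of ℂ ((Fin n → ι) → ℂ)
  map f := Hom.toFGModuleCat hE hd f
  map_id _ := FGModuleCat.hom_ext (Hom.evalLin_id hE hd _)
  map_comp f g := FGModuleCat.hom_ext (Hom.evalLin_comp hE hd f g)

instance : (modelFunctor hE hd).Additive where
  map_add {_ _ f g} := FGModuleCat.hom_ext (Hom.evalLin_add hE hd f g)

instance : (modelFunctor hE hd).Linear ℂ where
  map_smul f c := FGModuleCat.hom_ext (Hom.evalLin_smul hE hd c f)

/-- The monoidal structure of `modelFunctor`: concatenation of words. -/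
noncomputable def modelCore : (modelFunctor hE hd).CoreMonoidal where
  εIso := LinearEquiv.toFGModuleCatIso (LinearEquiv.funUnique (Fin 0 → ι) ℂ ℂ).symm
  μIso := fun (m n : ℕ) => LinearEquiv.toFGModuleCatIso (wordTensorEquiv ι m n)
  μIso_hom_natural_left := fun {m n} f (l : ℕ) => by
    refine FGModuleCat.hom_ext (TensorProduct.ext' fun x y => ?_)
    have h := Hom.wordTensorEquiv_evalLin hE hd x y f (Hom.mk d (Term.id l))
    rw [Hom.evalLin_id] at h
    exact h
  μIso_hom_natural_right := fun {m n} (l : ℕ) f => by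
    refine FGModuleCat.hom_ext (TensorProduct.ext' fun x y => ?_)
    have h := Hom.wordTensorEquiv_evalLin hE hd x y (Hom.mk d (Term.id l)) f
    rw [Hom.evalLin_id] at h
    exact h
  associativity := fun (l m n : ℕ) => by
    refine FGModuleCat.hom_ext (TensorProduct.ext_threefold fun x y z => ?_)
    rw [associator_hom]
    exact Hom.wordTensorEquiv_assoc hE hd x y z
  left_unitality := fun (m : ℕ) => by
    refine FGModuleCat.hom_ext (TensorProduct.ext' fun (c : ℂ) x => ?_)
    rw [leftUnitor_hom]
    refine funext fun w => (Eq.trans ?_ (Hom.evalLin_eqTo hE hd (Nat.zero_add m) _ w).symm)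
    erw [wordTensorEquiv_tmul]
    change c * x w = c * x (fun i => w (Fin.cast _ (Fin.natAdd 0 i)))
    exact congrArg (c * x ·) (funext fun i => congrArg w (Fin.ext (by simp)))
  right_unitality := fun (m : ℕ) => by
    refine FGModuleCat.hom_ext (TensorProduct.ext' fun x (c : ℂ) => ?_)
    rw [rightUnitor_hom]
    refine funext fun w => (Eq.trans ?_ (Hom.evalLin_eqTo hE hd (Nat.add_zero m) _ w).symm)
    erw [wordTensorEquiv_tmul]
    exact mul_comm c _

/-- The fiber functor attached to an invertible matrix `E` with `∑ E i j * E⁻¹ i j = d`. -/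
noncomputable def modelFiberFunctor : FiberFunctor d where
  F := modelFunctor hE hd
  monoidal := (modelCore hE hd).toMonoidal

omit [DecidableEq ι] in
theorem wordTensorEquiv_letters (i j : ι) :
    wordTensorEquiv ι 1 1 (Pi.basisFun ℂ _ (fun _ => i) ⊗ₜ Pi.basisFun ℂ _ (fun _ => j)) =
      Pi.basisFun ℂ _ ![i, j] := by
  classical
  ext w
  rw [wordTensorEquiv_tmul]
  simp only [Pi.basisFun_apply, Pi.single_apply]
  rw [ite_zero_mul_ite_zero, mul_one]
  congr 1
  simp [funext_iff, Fin.forall_fin_two]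

/-- The standard basis of `F(X) = ℂ^ι` for the model fiber functor. -/
noncomputable def modelBasis : Module.Basis ι ℂ (modelFiberFunctor hE hd).V :=
  (Pi.basisFun ℂ (Fin 1 → ι)).reindex (Equiv.funUnique (Fin 1) ι)

theorem modelFiberFunctor_form (i j : ι) :
    (modelFiberFunctor hE hd).form (modelBasis hE hd i ⊗ₜ modelBasis hE hd j) = E i j := by
  have h1 (i : ι) : modelBasis hE hd i = Pi.basisFun ℂ (Fin 1 → ι) (fun _ => i) :=
    (Pi.basisFun ℂ (Fin 1 → ι)).reindex_apply (Equiv.funUnique (Fin 1) ι) i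
  rw [h1, h1]
  change Hom.evalLin hE hd (Hom.mk d Term.cap) (wordTensorEquiv ι 1 1 (_ ⊗ₜ _)) _ = _
  rw [wordTensorEquiv_letters, Pi.basisFun_apply]
  refine (congrFun (Matrix.single_one_vecMul _ _) _).trans ?_
  rfl

end Model

/-! ### Extending isomorphisms along the arcs -/

section MonoidalFunctors

open Functor.LaxMonoidal Functor.OplaxMonoidal

/-- The arc `δ : I ⟶ X ⊗ X`. -/
def TL.δ (d : ℂ) : 𝟙_ (TL d) ⟶ TL.X d ⊗ TL.X d := Hom.mk d Term.cup

/-- One of the two zigzags, with the coherence isomorphisms of the strict category `TL d` put in so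
that the relation can be transported along a monoidal functor. -/
theorem TL.zigzag (d : ℂ) :
    (λ_ (TL.X d)).inv ≫ TL.δ d ▷ TL.X d ≫ (α_ _ _ _).hom ≫ TL.X d ◁ TL.ε d ≫ (ρ_ (TL.X d)).hom =
      𝟙 (TL.X d) := by
  have h1 : (λ_ (TL.X d)).inv = 𝟙 (TL.X d) := rfl
  have h2 : (ρ_ (TL.X d)).hom = 𝟙 (TL.X d) := rfl
  have h3 : (α_ (TL.X d) (TL.X d) (TL.X d)).hom = 𝟙 _ := rfl
  have h4 : (TL.δ d ▷ TL.X d) ≫ (TL.X d ◁ TL.ε d) = 𝟙 (TL.X d) := Hom.sound Rel.zigzag_left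
  erw [h1, h2, h3, Category.id_comp, Category.id_comp, Category.comp_id]
  exact h4

theorem TL.loop (d : ℂ) : TL.δ d ≫ TL.ε d = d • 𝟙 (𝟙_ (TL d)) := Hom.sound Rel.loop

/-- Every object is an iterated tensor power `((I ⊗ X) ⊗ X) ⊗ ⋯` of the generating one. -/
theorem TL.objInduction {d : ℂ} {P : TL d → Prop} (unit : P (𝟙_ (TL d)))
    (tensor_X : ∀ n, P n → P (n ⊗ TL.X d)) (n : TL d) : P n :=
  Nat.rec (motive := fun n : ℕ => P n) unit tensor_X n

/-- The two arcs generate all morphisms. -/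
theorem TL.homInduction {d : ℂ} {P : ∀ {m n : TL d}, (m ⟶ n) → Prop} (id : ∀ n : TL d, P (𝟙 n))
    (comp : ∀ {l m n : TL d} (f : l ⟶ m) (g : m ⟶ n), P f → P g → P (f ≫ g))
    (tensor : ∀ {m n m' n' : TL d} (f : m ⟶ n) (g : m' ⟶ n'), P f → P g → P (f ⊗ₘ g))
    (cap : P (TL.ε d)) (cup : P (TL.δ d)) (zero : ∀ m n : TL d, P (0 : m ⟶ n))
    (add : ∀ {m n : TL d} (f g : m ⟶ n), P f → P g → P (f + g))
    (smul : ∀ {m n : TL d} (c : ℂ) (f : m ⟶ n), P f → P (c • f))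
    {m n : TL d} (f : m ⟶ n) : P f := by
  obtain ⟨f, rfl⟩ := Hom.exists_rep f
  induction f with
  | id n => exact id n
  | comp f g ih ih' => exact comp _ _ ih ih'
  | tensor f g ih ih' => exact tensor _ _ ih ih'
  | cap => exact cap
  | cup => exact cup
  | zero m n => exact zero m n
  | add f g ih ih' => exact add _ _ ih ih'
  | smul c f ih => exact smul c _ ih

section Extension

variable {d : ℂ} {D : Type*} [Category D] [MonoidalCategory D] (F G : TL d ⥤ D)

/-- The image of the arc `ε` under a monoidal functor, as a morphism `F X ⊗ F X ⟶ I`. -/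
def capHom [F.Monoidal] : F.obj (TL.X d) ⊗ F.obj (TL.X d) ⟶ 𝟙_ D :=
  μ F (TL.X d) (TL.X d) ≫ F.map (TL.ε d) ≫ η F

/-- The image of the arc `δ` under a monoidal functor, as a morphism `I ⟶ F X ⊗ F X`. -/
def cupHom [F.Monoidal] : 𝟙_ D ⟶ F.obj (TL.X d) ⊗ F.obj (TL.X d) :=
  ε F ≫ F.map (TL.δ d) ≫ Functor.OplaxMonoidal.δ F (TL.X d) (TL.X d)

theorem cupHom_capHom_zigzag [F.Monoidal] :
    (λ_ (F.obj (TL.X d))).inv ≫ cupHom F ▷ F.obj (TL.X d) ≫ (α_ _ _ _).hom ≫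
      F.obj (TL.X d) ◁ capHom F ≫ (ρ_ (F.obj (TL.X d))).hom = 𝟙 _ := by
  have h := congrArg F.map (TL.zigzag d)
  rw [F.map_id] at h
  rw [← h]
  simp only [cupHom, capHom, Functor.map_comp, Functor.Monoidal.map_whiskerLeft,
    Functor.Monoidal.map_whiskerRight, Functor.Monoidal.map_associator,
    Functor.Monoidal.map_leftUnitor_inv, Functor.Monoidal.map_rightUnitor, Category.assoc,
    Functor.Monoidal.μ_δ_assoc, comp_whiskerRight, MonoidalCategory.whiskerLeft_comp]

theorem cupHom_comp_capHom [Preadditive D] [Linear ℂ D] [F.Monoidal] [F.Linear ℂ] :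
    cupHom F ≫ capHom F = d • 𝟙 (𝟙_ D) := by
  simp only [cupHom, capHom, Category.assoc, Functor.Monoidal.δ_μ_assoc]
  rw [← F.map_comp_assoc, TL.loop, F.map_smul]
  simp

variable [F.Monoidal] [G.Monoidal] {F G}

section Family

-- A family `t` of isomorphisms, not assumed natural, that is determined recursively by its value
-- `φ` on `X` and compatibility with tensoring by `X` on the right.
variable {φ : F.obj (TL.X d) ≅ G.obj (TL.X d)} {t : ∀ n : TL d, F.obj n ≅ G.obj n}

omit [MonoidalCategory D] [F.Monoidal] [G.Monoidal] in
/-- Naturality with respect to the coherence isomorphisms, which in `TL d` are identities. -/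
theorem family_eqToHom (t : ∀ n : TL d, F.obj n ≅ G.obj n) {m n : TL d} (h : m = n) :
    F.map (eqToHom h) ≫ (t n).hom = (t m).hom ≫ G.map (eqToHom h) := by
  subst h
  simp

variable (h₀ : (t (𝟙_ (TL d))).hom = η F ≫ ε G)
  (h₁ : ∀ n, μ F n (TL.X d) ≫ (t (n ⊗ TL.X d)).hom = ((t n).hom ⊗ₘ φ.hom) ≫ μ G n (TL.X d))

include h₀ h₁

theorem family_X : (t (TL.X d)).hom = φ.hom := by
  have h := h₁ (𝟙_ (TL d))
  have h2 : F.map (λ_ (TL.X d)).hom ≫ (t (TL.X d)).hom = (t _).hom ≫ G.map (λ_ (TL.X d)).hom :=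
    family_eqToHom t (Nat.zero_add 1)
  rw [← cancel_epi (F.map (λ_ (TL.X d)).hom), ← cancel_epi (μ F (𝟙_ (TL d)) (TL.X d)), h2,
    reassoc_of% h, h₀]
  simp only [Functor.Monoidal.map_leftUnitor, Functor.Monoidal.μ_δ_assoc, Category.assoc]
  rw [MonoidalCategory.tensorHom_def', MonoidalCategory.comp_whiskerRight]
  simp only [Category.assoc, Functor.Monoidal.whiskerRight_ε_η_assoc, leftUnitor_naturality,
    whisker_exchange_assoc]

/-- Compatibility with `- ⊗ X` propagates to all tensor products, by induction on the right
factor. -/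
theorem family_tensor (m n : TL d) :
    μ F m n ≫ (t (m ⊗ n)).hom = ((t m).hom ⊗ₘ (t n).hom) ≫ μ G m n := by
  induction n using TL.objInduction with
  | unit =>
    have h2 : F.map (ρ_ m).hom ≫ (t m).hom = (t _).hom ≫ G.map (ρ_ m).hom :=
      family_eqToHom t (Nat.add_zero (m : ℕ))
    rw [← cancel_mono (G.map (ρ_ m).hom), Category.assoc, ← h2, h₀]
    simp only [Functor.Monoidal.map_rightUnitor, Functor.Monoidal.μ_δ_assoc, Category.assoc]
    rw [MonoidalCategory.tensorHom_def, MonoidalCategory.whiskerLeft_comp]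
    simp only [Category.assoc, Functor.Monoidal.whiskerLeft_ε_η_assoc, rightUnitor_naturality,
      ← whisker_exchange_assoc]
  | tensor_X n ih =>
    have h2 : F.map (α_ m n (TL.X d)).inv ≫ (t _).hom = (t _).hom ≫ G.map (α_ m n (TL.X d)).inv :=
      family_eqToHom t (Nat.add_assoc (m : ℕ) n 1).symm
    rw [← cancel_epi (F.obj m ◁ μ F n (TL.X d)), ← cancel_mono (G.map (α_ m n (TL.X d)).inv)]
    calc _ = (F.obj m ◁ μ F n (TL.X d) ≫ μ F m (n ⊗ TL.X d) ≫ F.map (α_ m n (TL.X d)).inv) ≫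
          (t _).hom := by simp only [Category.assoc, h2]
      _ = (α_ _ _ _).inv ≫ ((μ F m n ≫ (t (m ⊗ n)).hom) ⊗ₘ φ.hom) ≫ μ G (m ⊗ n) (TL.X d) := by
        rw [Functor.LaxMonoidal.associativity_inv]
        simp only [Category.assoc, h₁, whiskerRight_comp_tensorHom_assoc]
      _ = ((t m).hom ⊗ₘ ((t n).hom ⊗ₘ φ.hom)) ≫ G.obj m ◁ μ G n (TL.X d) ≫
          μ G m (n ⊗ TL.X d) ≫ G.map (α_ m n (TL.X d)).inv := by
        rw [ih, Functor.LaxMonoidal.associativity_inv, associator_inv_naturality_assoc,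
          tensorHom_comp_whiskerRight_assoc]
      _ = _ := by
        rw [tensorHom_comp_whiskerLeft_assoc, ← h₁]
        simp only [Category.assoc, whiskerLeft_comp_tensorHom_assoc]

end Family

variable (φ : F.obj (TL.X d) ≅ G.obj (TL.X d))

/-- The tensor powers of an isomorphism `φ : F X ≅ G X`, transported to isomorphisms
`F n ≅ G n` through the structure maps. -/
def extend (n : TL d) : F.obj n ≅ G.obj n :=
  Nat.rec (motive := fun n : ℕ => F.obj n ≅ G.obj n)
  ((Functor.Monoidal.εIso F).symm ≪≫ Functor.Monoidal.εIso G)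
  (fun n t => (Functor.Monoidal.μIso F n (TL.X d)).symm ≪≫
      (t ⊗ᵢ φ) ≪≫ Functor.Monoidal.μIso G n (TL.X d)) n

theorem extend_unit : (extend φ (𝟙_ (TL d))).hom = η F ≫ ε G := rfl

theorem extend_tensor_X (n : TL d) :
    μ F n (TL.X d) ≫ (extend φ (n ⊗ TL.X d)).hom =
      ((extend φ n).hom ⊗ₘ φ.hom) ≫ μ G n (TL.X d) := by
  change _ ≫ (Functor.OplaxMonoidal.δ F n (TL.X d) ≫ _ ≫ _) = _
  rw [Functor.Monoidal.μ_δ_assoc]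
  rfl

theorem extend_X : (extend φ (TL.X d)).hom = φ.hom :=
  family_X (extend_unit φ) (extend_tensor_X φ)

theorem extend_tensor (m n : TL d) :
    μ F m n ≫ (extend φ (m ⊗ n)).hom = ((extend φ m).hom ⊗ₘ (extend φ n).hom) ≫ μ G m n :=
  family_tensor (extend_unit φ) (extend_tensor_X φ) m n

/-- The tensor powers of `φ` are natural as soon as `φ` respects the images of the two arcs. -/
theorem extend_naturality [Preadditive D] [Linear ℂ D] [F.Additive] [G.Additive] [F.Linear ℂ]
    [G.Linear ℂ] (hcap : (φ.hom ⊗ₘ φ.hom) ≫ capHom G = capHom F)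
    (hcup : cupHom F ≫ (φ.hom ⊗ₘ φ.hom) = cupHom G) {m n : TL d} (f : m ⟶ n) :
    F.map f ≫ (extend φ n).hom = (extend φ m).hom ≫ G.map f := by
  have hXX := extend_tensor φ (TL.X d) (TL.X d)
  rw [extend_X] at hXX
  induction f using TL.homInduction with
  | id n => simp
  | comp f g ih ih' => rw [F.map_comp, G.map_comp, Category.assoc, ih', reassoc_of% ih]
  | zero m n => simp
  | add f g ih ih' => simp [ih, ih']
  | smul c f ih => simp [ih]
  | tensor f g ih ih' =>
    rw [← cancel_epi (μ F _ _), ← Functor.LaxMonoidal.μ_natural_assoc, extend_tensor,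
      reassoc_of% extend_tensor φ, ← Functor.LaxMonoidal.μ_natural,
      MonoidalCategory.tensorHom_comp_tensorHom_assoc,
      MonoidalCategory.tensorHom_comp_tensorHom_assoc, ih, ih']
  | cap =>
    rw [← cancel_epi (μ F _ _), reassoc_of% hXX, ← cancel_mono (η G), extend_unit]
    simpa [capHom] using hcap.symm
  | cup =>
    rw [← cancel_epi (ε F), ← cancel_mono (Functor.OplaxMonoidal.δ G _ _), extend_unit]
    have h : (extend φ (TL.X d ⊗ TL.X d)).hom =
        Functor.OplaxMonoidal.δ F _ _ ≫ (φ.hom ⊗ₘ φ.hom) ≫ μ G _ _ := by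
      rw [← hXX, Functor.Monoidal.δ_μ_assoc]
    rw [h]
    simpa [cupHom] using hcup

/-- The monoidal natural isomorphism extending an isomorphism `F X ≅ G X` that respects the images
of the two arcs. -/
def extendIso [Preadditive D] [Linear ℂ D] [F.Additive] [G.Additive] [F.Linear ℂ]
    [G.Linear ℂ] (hcap : (φ.hom ⊗ₘ φ.hom) ≫ capHom G = capHom F)
    (hcup : cupHom F ≫ (φ.hom ⊗ₘ φ.hom) = cupHom G) : F ≅ G :=
  NatIso.ofComponents (extend φ) (extend_naturality φ hcap hcup)

instance [Preadditive D] [Linear ℂ D] [F.Additive] [G.Additive] [F.Linear ℂ]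
    [G.Linear ℂ] (hcap : (φ.hom ⊗ₘ φ.hom) ≫ capHom G = capHom F)
    (hcup : cupHom F ≫ (φ.hom ⊗ₘ φ.hom) = cupHom G) :
    NatTrans.IsMonoidal (extendIso φ hcap hcup).hom where
  unit := by simp [extendIso, extend_unit]
  tensor m n := by simp [extendIso, extend_tensor]

omit φ in
/-- A monoidal transformation preserves the images of the arc. -/
theorem tensorHom_app_capHom (t : F ⟶ G) [NatTrans.IsMonoidal t] :
    (t.app (TL.X d) ⊗ₘ t.app (TL.X d)) ≫ capHom G = capHom F := by
  rw [capHom, ← NatTrans.IsMonoidal.tensor_assoc, ← t.naturality_assoc]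
  have h : t.app (𝟙_ (TL d)) ≫ η G = η F := by
    rw [← cancel_epi (ε F), NatTrans.IsMonoidal.unit_assoc]
    simp
  rw [h, capHom]

end Extension

end MonoidalFunctors

/-! ### The bilinear space of a fiber functor -/

namespace FiberFunctor

variable {d : ℂ} (F G : FiberFunctor d)

/-- The tensor `F(δ)(1) ∈ F(X) ⊗ F(X)`. -/
noncomputable def coform : F.V ⊗[ℂ] F.V := (cupHom F.F).hom.hom (1 : ℂ)

theorem form_coform : F.form F.coform = d := by
  have h := congrArg (fun f => f.hom.hom (1 : ℂ)) (cupHom_comp_capHom F.F)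
  exact h.trans (mul_one d)

/-- The zigzag relation, evaluated at a vector: contracting the second leg of `coform` with `v`
returns `v`. -/
theorem contract_coform (v : F.V) :
    TensorProduct.rid ℂ F.V (F.form.lTensor F.V (TensorProduct.assoc ℂ F.V F.V F.V
      (F.coform ⊗ₜ v))) = v :=
  congrArg (fun f => f.hom.hom v) (cupHom_capHom_zigzag F.F)

section Basis

variable {ι : Type*} [Fintype ι] [DecidableEq ι] (b : Module.Basis ι ℂ F.V)

/-- The matrix of the bilinear form `F(ε)` in a basis indexed by an arbitrary finite type; for the
index type `Fin N` this is `formMatrix`. -/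
noncomputable def gram : Matrix ι ι ℂ := Matrix.of fun i j => F.form (b i ⊗ₜ b j)

/-- The coordinates of the tensor `coform` in the basis `b ⊗ b`. -/
noncomputable def cogram : Matrix ι ι ℂ :=
  Matrix.of fun i j => (b.tensorProduct b).repr F.coform (i, j)

omit [DecidableEq ι] in
theorem coform_eq_sum : F.coform = ∑ i, ∑ j, F.cogram b i j • (b i ⊗ₜ[ℂ] b j) := by
  conv_lhs => rw [← (b.tensorProduct b).sum_repr F.coform]
  rw [Fintype.sum_prod_type]
  simp only [Module.Basis.tensorProduct_apply]
  rfl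

theorem cogram_mul_gram : F.cogram b * F.gram b = 1 := by
  ext i k
  have h := F.contract_coform (b k)
  rw [F.coform_eq_sum b] at h
  simp only [TensorProduct.sum_tmul, TensorProduct.smul_tmul', map_sum,
    TensorProduct.assoc_tmul, LinearMap.lTensor_tmul, TensorProduct.rid_tmul] at h
  have h := congrArg (fun x => b.repr x i) h
  simp only [map_sum, map_smul, Module.Basis.repr_self, Finsupp.coe_finsetSum, Finset.sum_apply,
    Finsupp.smul_apply, Finsupp.single_apply, smul_eq_mul, mul_ite, mul_one, mul_zero] at h
  simpa [Matrix.mul_apply, Matrix.one_apply, gram, mul_comm, eq_comm] using h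

theorem isUnit_gram : IsUnit (F.gram b) :=
  IsUnit.of_mul_eq_one_right _ (F.cogram_mul_gram b)

theorem cogram_eq_inv : F.cogram b = (F.gram b)⁻¹ :=
  (Matrix.inv_eq_left_inv (F.cogram_mul_gram b)).symm

/-- The loop relation in coordinates. -/
theorem trace_inv_gram_mul_transpose : ((F.gram b)⁻¹ * (F.gram b).transpose).trace = d := by
  refine Eq.trans ?_ F.form_coform
  rw [F.coform_eq_sum b, ← cogram_eq_inv]
  simp [Matrix.trace, Matrix.mul_apply, gram]

end Basis

variable {F G}

/-- A fiber functor is determined up to isomorphism by the bilinear space `F(X)`: an isometry also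
respects the images of `δ`, whose coordinates are the inverse of the matrix of the form. -/
theorem equiv_of_isometry (φ : F.V ≃ₗ[ℂ] G.V)
    (h : ∀ x y, G.form (φ x ⊗ₜ φ y) = F.form (x ⊗ₜ y)) : F ≈ G := by
  classical
  let φ' : F.V ≅ G.V := LinearEquiv.toFGModuleCatIso φ
  let b := Module.finBasis ℂ F.V
  have hg : G.gram (b.map φ) = F.gram b := by
    ext i j
    simp [gram, h]
  have hcap : (φ'.hom ⊗ₘ φ'.hom) ≫ capHom G.F = capHom F.F :=
    FGModuleCat.hom_ext (TensorProduct.ext' h)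
  have hcup : cupHom F.F ≫ (φ'.hom ⊗ₘ φ'.hom) = cupHom G.F := by
    refine FGModuleCat.hom_ext (LinearMap.ext_ring ?_)
    change TensorProduct.map φ.toLinearMap φ.toLinearMap F.coform = G.coform
    rw [F.coform_eq_sum b, G.coform_eq_sum (b.map φ), cogram_eq_inv, cogram_eq_inv, hg]
    simp
  exact ⟨extendIso φ' hcap hcup, inferInstance⟩

theorem exists_isometry (h : F ≈ G) :
    ∃ φ : F.V ≃ₗ[ℂ] G.V, ∀ x y, G.form (φ x ⊗ₜ φ y) = F.form (x ⊗ₜ y) := by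
  obtain ⟨t, ht⟩ := h
  refine ⟨FGModuleCat.isoToLinearEquiv (t.app (TL.X d)), fun x y => ?_⟩
  exact congrArg (fun f => f.hom.hom (x ⊗ₜ y)) (tensorHom_app_capHom t.hom)

theorem exists_gram_eq {ι : Type} [Fintype ι] [DecidableEq ι] {E : Matrix ι ι ℂ} (hE : IsUnit E)
    (hd : (E⁻¹ * E.transpose).trace = d) :
    ∃ (F : FiberFunctor d) (b : Module.Basis ι ℂ F.V), F.gram b = E := by
  have hd : ∑ i, ∑ j, E i j * E⁻¹ i j = d := by
    rw [← hd]
    simp [Matrix.trace, Matrix.mul_apply, mul_comm]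
  exact ⟨modelFiberFunctor hE hd, modelBasis hE hd,
    Matrix.ext fun i j => modelFiberFunctor_form hE hd i j⟩

end FiberFunctor

/-! ### Asymmetry and congruence -/

open Polynomial in
/-- `X` has a square root modulo every polynomial that does not vanish at `0`.  An interpolation
polynomial through square roots of the zeros is a square root up to a nilpotent, and Newton's
iteration improves it to an exact one. -/
theorem exists_sq_modEq_X {χ : ℂ[X]} (hχ : χ.Monic) (h0 : χ.coeff 0 ≠ 0) :
    ∃ p : ℂ[X], χ ∣ p ^ 2 - X := by
  choose w hw using fun z : ℂ => IsAlgClosed.exists_pow_nat_eq z (n := 2) two_pos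
  let q : ℂ[X] := Lagrange.interpolate χ.roots.toFinset id w
  have hq : ∀ z ∈ χ.roots, X - C z ∣ q ^ 2 - X := by
    intro z hz
    have h : q.eval z = w z :=
      Lagrange.eval_interpolate_at_node w (v := id) (fun _ _ _ _ h => h) (by simpa using hz)
    rw [dvd_iff_isRoot]
    simp [h, hw]
  have hdvd : χ ∣ (q ^ 2 - X) ^ Multiset.card χ.roots := by
    have h := Multiset.prod_dvd_prod_of_dvd (S := χ.roots) (fun z => X - C z)
      (fun _ => q ^ 2 - X) hq
    have h2 := (IsAlgClosed.splits χ).eq_prod_roots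
    rw [hχ.leadingCoeff, C_1, one_mul] at h2
    rw [← h2] at h
    simpa using h
  have hX : IsUnit (AdjoinRoot.root χ) := by
    have hco : IsCoprime X χ := by
      rw [Polynomial.irreducible_X.coprime_iff_not_dvd, X_dvd_iff]
      exact h0
    obtain ⟨a, b, hab⟩ := hco
    have h := congrArg (AdjoinRoot.mk χ) hab
    simp at h
    exact IsUnit.of_mul_eq_one_right _ h
  have hnil : IsNilpotent (AdjoinRoot.mk χ q ^ 2 - AdjoinRoot.root χ) :=
    ⟨_, by
      have h := AdjoinRoot.mk_eq_zero.2 hdvd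
      simpa using h⟩
  have hunit : IsUnit (AdjoinRoot.mk χ q) := by
    rw [← isUnit_pow_iff two_ne_zero]
    have h := hnil.isUnit_add_left_of_commute hX (Commute.all _ _)
    simpa using h
  obtain ⟨r, ⟨-, hr⟩, -⟩ := existsUnique_nilpotent_sub_and_aeval_eq_zero
    (P := (X ^ 2 - C (AdjoinRoot.root χ) : (AdjoinRoot χ)[X])) (x := AdjoinRoot.mk χ q)
    (by simpa using hnil)
    (by
      have h2 : IsUnit (2 : AdjoinRoot χ) := by
        simpa only [map_ofNat] using
          (IsUnit.mk0 (2 : ℂ) two_ne_zero).map (algebraMap ℂ (AdjoinRoot χ))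
      simpa [derivative_X_pow, one_add_one_eq_two] using (h2.mul hunit))
  obtain ⟨p, rfl⟩ := AdjoinRoot.mk_surjective r
  refine ⟨p, AdjoinRoot.mk_eq_zero.1 ?_⟩
  simpa using hr

open Polynomial in
/-- An invertible complex matrix has a square root which is a polynomial in it. -/
theorem exists_polynomial_sq_eq {n : Type*} [Fintype n] [DecidableEq n] {A : Matrix n n ℂ}
    (hA : IsUnit A) : ∃ p : ℂ[X], aeval A p ^ 2 = A := by
  have h0 : A.charpoly.coeff 0 ≠ 0 := by
    intro h
    have h2 := A.det_eq_sign_charpoly_coeff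
    rw [h, mul_zero] at h2
    exact ((Matrix.isUnit_iff_isUnit_det A).1 hA).ne_zero h2
  obtain ⟨p, q, hp⟩ := exists_sq_modEq_X A.charpoly_monic h0
  refine ⟨p, ?_⟩
  have h := congrArg (aeval A) hp
  simpa [Matrix.aeval_self_charpoly, sub_eq_zero] using h

open Polynomial in
theorem transpose_aeval_mul {n : Type*} [Fintype n] [DecidableEq n] {A E : Matrix n n ℂ}
    (h : A.transpose * E = E * A) (p : ℂ[X]) :
    (aeval A p).transpose * E = E * aeval A p := by
  induction p using Polynomial.induction_on with
  | C a => simp [Algebra.algebraMap_eq_smul_one]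
  | add p q hp hq => simp [add_mul, mul_add, hp, hq]
  | monomial k a ih =>
    have hs : aeval A (C a * X ^ (k + 1)) = aeval A (C a * X ^ k) * A := by
      rw [pow_succ, ← mul_assoc, map_mul, aeval_X]
    have hc : A * aeval A (C a * X ^ k) = aeval A (C a * X ^ k) * A := by
      have h := congrArg (aeval A) (mul_comm X (C a * X ^ k))
      rwa [map_mul (aeval A) X, map_mul (aeval A) (C a * X ^ k), aeval_X] at h
    rw [hs, Matrix.transpose_mul, mul_assoc, ih, ← mul_assoc, h, mul_assoc, hc]

/-- Two invertible matrices with the same asymmetry are congruent: `A = E⁻¹ * E'` satisfies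
`ᵗA * E = E * A`, and this passes to a square root `B` of `A` that is a polynomial in `A`, so that
`ᵗB * E * B = E * B ^ 2 = E'`. -/
theorem exists_congruence_of_theta_eq {n : Type*} [Fintype n] [DecidableEq n]
    {E E' : Matrix n n ℂ} (hE : IsUnit E) (hE' : IsUnit E')
    (h : E⁻¹ * E.transpose = E'⁻¹ * E'.transpose) :
    ∃ B : Matrix n n ℂ, IsUnit B ∧ E' = B.transpose * E * B := by
  have e1 : E * E⁻¹ = 1 := Matrix.mul_nonsing_inv _ ((Matrix.isUnit_iff_isUnit_det _).1 hE)
  have e2 : E' * E'⁻¹ = 1 := Matrix.mul_nonsing_inv _ ((Matrix.isUnit_iff_isUnit_det _).1 hE')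
  set A := E⁻¹ * E' with hAdef
  have hA : IsUnit A := (Matrix.isUnit_nonsing_inv_iff.2 hE).mul hE'
  have hEA : E' = E * A := by rw [hAdef, ← mul_assoc, e1, one_mul]
  have hEt : E.transpose = E * (E⁻¹ * E.transpose) := by rw [← mul_assoc, e1, one_mul]
  have hEt' : E'.transpose = E' * (E⁻¹ * E.transpose) := by rw [h, ← mul_assoc, e2, one_mul]
  have hΘ : IsUnit (E⁻¹ * E.transpose) :=
    (Matrix.isUnit_nonsing_inv_iff.2 hE).mul ((Matrix.isUnit_transpose _).2 hE)
  set T := E⁻¹ * E.transpose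
  have h1 : A.transpose * E.transpose = E * A * T := by
    rw [← Matrix.transpose_mul, ← hEA, hEt']
  have hAE : A.transpose * E = E * A := by
    rw [hEt, ← mul_assoc] at h1
    exact hΘ.mul_right_cancel h1
  obtain ⟨p, hp⟩ := exists_polynomial_sq_eq hA
  refine ⟨Polynomial.aeval A p, ?_, ?_⟩
  · rw [← isUnit_pow_iff two_ne_zero, hp]
    exact hA
  · rw [transpose_aeval_mul hAE, mul_assoc, ← sq, hp, hEA]

/-- A change of basis conjugates the asymmetry `E⁻¹ * ᵗE` of a bilinear form. -/
theorem mul_inv_mul_transpose_congruence {n : Type*} [Fintype n] [DecidableEq n]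
    {E S : Matrix n n ℂ} (hS : IsUnit S) :
    S * ((S.transpose * E * S)⁻¹ * (S.transpose * E * S).transpose) =
      E⁻¹ * E.transpose * S := by
  have hS' := (Matrix.isUnit_iff_isUnit_det _).1 hS
  have hSt : IsUnit S.transpose.det := by rwa [Matrix.det_transpose]
  have h1 : S * S⁻¹ = 1 := Matrix.mul_nonsing_inv _ hS'
  have h2 : S.transpose⁻¹ * S.transpose = 1 := Matrix.nonsing_inv_mul _ hSt
  rw [Matrix.mul_inv_rev, Matrix.mul_inv_rev, Matrix.transpose_mul, Matrix.transpose_mul,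
    Matrix.transpose_transpose]
  calc S * (S⁻¹ * (E⁻¹ * S.transpose⁻¹) * (S.transpose * (E.transpose * S)))
      = (S * S⁻¹) * E⁻¹ * (S.transpose⁻¹ * S.transpose) * E.transpose * S := by
        simp only [mul_assoc]
    _ = E⁻¹ * E.transpose * S := by rw [h1, h2, one_mul, mul_one]

/-- The similarity class of the asymmetry determines the bilinear form up to congruence. -/
theorem exists_congruence_of_theta_similar {n : Type*} [Fintype n] [DecidableEq n]
    {E E' S : Matrix n n ℂ} (hE : IsUnit E) (hE' : IsUnit E') (hS : IsUnit S)
    (h : S * (E'⁻¹ * E'.transpose) = E⁻¹ * E.transpose * S) :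
    ∃ B : Matrix n n ℂ, IsUnit B ∧ E' = B.transpose * E * B := by
  obtain ⟨B, hB, h2⟩ := exists_congruence_of_theta_eq (E := S.transpose * E * S)
    ((((Matrix.isUnit_transpose _).2 hS).mul hE).mul hS) hE'
    (hS.mul_left_cancel ((mul_inv_mul_transpose_congruence hS).trans h.symm))
  exact ⟨S * B, hS.mul hB, by rw [h2, Matrix.transpose_mul]; simp only [mul_assoc]⟩

theorem isUnit_theta {N : ℕ} {E : Matrix (Fin N) (Fin N) ℂ} (hE : IsUnit E) : IsUnit (Θ E) :=
  (Matrix.isUnit_nonsing_inv_iff.2 hE).mul ((Matrix.isUnit_transpose _).2 hE)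

/-! ### Nullities and Jordan multiplicities -/

section Nullity

variable {V W : Type*} [AddCommGroup V] [Module ℂ V] [AddCommGroup W] [Module ℂ W]

/-- The dimension of the kernel of `(f - z) ^ k`. -/
noncomputable def nullity (f : Module.End ℂ V) (z : ℂ) (k : ℕ) : ℕ :=
  Module.finrank ℂ (LinearMap.ker ((f - algebraMap ℂ (Module.End ℂ V) z) ^ k))

theorem nullity_congr {f : Module.End ℂ V} {g : Module.End ℂ W} (e : V ≃ₗ[ℂ] W)
    (h : ∀ v, g (e v) = e (f v)) (z : ℂ) (k : ℕ) : nullity f z k = nullity g z k := by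
  have hk : ∀ (k : ℕ) (v : V), ((g - algebraMap ℂ (Module.End ℂ W) z) ^ k) (e v) =
      e (((f - algebraMap ℂ (Module.End ℂ V) z) ^ k) v) := by
    intro k
    induction k with
    | zero => simp
    | succ k ih => intro v; simp [pow_succ, h, ← ih]
  have hker : LinearMap.ker ((g - algebraMap ℂ (Module.End ℂ W) z) ^ k) =
      (LinearMap.ker ((f - algebraMap ℂ (Module.End ℂ V) z) ^ k)).map e.toLinearMap := by
    ext w
    obtain ⟨v, rfl⟩ := e.surjective w
    simp [hk]
  rw [nullity, nullity, hker]
  exact (LinearEquiv.finrank_map_eq e _).symm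

theorem nullity_pi {α : Type*} [Fintype α] {V : α → Type*} [∀ a, AddCommGroup (V a)]
    [∀ a, Module ℂ (V a)] [∀ a, Module.Finite ℂ (V a)] (f : ∀ a, Module.End ℂ (V a)) (z : ℂ)
    (k : ℕ) : nullity (LinearMap.piMap f) z k = ∑ a, nullity (f a) z k := by
  have hk : ∀ (k : ℕ) (v : ∀ a, V a) (a : α),
      ((LinearMap.piMap f - algebraMap ℂ (Module.End ℂ (∀ a, V a)) z) ^ k) v a =
      ((f a - algebraMap ℂ (Module.End ℂ (V a)) z) ^ k) (v a) := by
    intro k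
    induction k with
    | zero => simp
    | succ k ih => intro v a; simp [pow_succ, ih]
  let e : LinearMap.ker ((LinearMap.piMap f - algebraMap ℂ (Module.End ℂ (∀ a, V a)) z) ^ k) ≃ₗ[ℂ]
      ∀ a, LinearMap.ker ((f a - algebraMap ℂ (Module.End ℂ (V a)) z) ^ k) :=
    { toFun v a := ⟨v.1 a, by rw [LinearMap.mem_ker, ← hk, LinearMap.mem_ker.1 v.2]; rfl⟩
      map_add' _ _ := rfl
      map_smul' _ _ := rfl
      invFun w := ⟨fun a => (w a).1, by
        rw [LinearMap.mem_ker]; funext a; rw [hk]; exact (w a).2⟩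
      left_inv _ := rfl
      right_inv _ := rfl }
  rw [nullity, e.finrank_eq, Module.finrank_pi_fintype]
  rfl

theorem nullity_prodMap [Module.Finite ℂ V] [Module.Finite ℂ W] (f : Module.End ℂ V)
    (g : Module.End ℂ W) (z : ℂ) (k : ℕ) :
    nullity (f.prodMap g) z k = nullity f z k + nullity g z k := by
  have hk : ∀ (k : ℕ) (v : V × W),
      ((f.prodMap g - algebraMap ℂ (Module.End ℂ (V × W)) z) ^ k) v =
      (((f - algebraMap ℂ (Module.End ℂ V) z) ^ k) v.1,
        ((g - algebraMap ℂ (Module.End ℂ W) z) ^ k) v.2) := by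
    intro k
    induction k with
    | zero => simp
    | succ k ih => intro v; simp [pow_succ, ih]
  let e : LinearMap.ker ((f.prodMap g - algebraMap ℂ (Module.End ℂ (V × W)) z) ^ k) ≃ₗ[ℂ]
      LinearMap.ker ((f - algebraMap ℂ (Module.End ℂ V) z) ^ k) ×
        LinearMap.ker ((g - algebraMap ℂ (Module.End ℂ W) z) ^ k) :=
    { toFun v := (⟨v.1.1, (Prod.ext_iff.1 ((hk k v.1).symm.trans v.2)).1⟩,
        ⟨v.1.2, (Prod.ext_iff.1 ((hk k v.1).symm.trans v.2)).2⟩)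
      map_add' _ _ := rfl
      map_smul' _ _ := rfl
      invFun w := ⟨(w.1.1, w.2.1), by
        rw [LinearMap.mem_ker, hk]; exact Prod.ext w.1.2 w.2.2⟩
      left_inv _ := rfl
      right_inv _ := rfl }
  rw [nullity, e.finrank_eq, Module.finrank_prod]
  rfl

theorem nullity_eq_zero_of_isNilpotent {V : Type*} [AddCommGroup V] [Module ℂ V]
    {f : Module.End ℂ V} {z w : ℂ} (hf : IsNilpotent (f - algebraMap ℂ (Module.End ℂ V) z))
    (h : z ≠ w) (j : ℕ) : nullity f w j = 0 := by
  have hu : IsUnit (algebraMap ℂ (Module.End ℂ V) (z - w)) :=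
    (IsUnit.mk0 _ (sub_ne_zero.2 h)).map _
  have hu2 := hf.isUnit_add_left_of_commute hu (Algebra.commute_algebraMap_right _ _)
  have heq : algebraMap ℂ (Module.End ℂ V) (z - w) + (f - algebraMap ℂ (Module.End ℂ V) z) =
      f - algebraMap ℂ (Module.End ℂ V) w := by
    rw [map_sub]; abel
  rw [heq] at hu2
  rw [nullity, LinearMap.ker_eq_bot.2, finrank_bot]
  exact ((Module.End.isUnit_iff _).1 (hu2.pow j)).injective

end Nullity

section NullityMatrix

variable {n : Type*} [Fintype n] [DecidableEq n]

theorem nullity_toLin'_add_rank (M : Matrix n n ℂ) (z : ℂ) (k : ℕ) :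
    nullity (Matrix.toLin' M) z k + ((M - algebraMap ℂ (Matrix n n ℂ) z) ^ k).rank =
      Fintype.card n := by
  have h : (Matrix.toLin' M - algebraMap ℂ (Module.End ℂ (n → ℂ)) z) ^ k =
      ((M - algebraMap ℂ (Matrix n n ℂ) z) ^ k).mulVecLin := by
    have h2 := map_pow (Matrix.toLinAlgEquiv' (R := ℂ) (n := n))
      (M - algebraMap ℂ (Matrix n n ℂ) z) k
    rw [map_sub, AlgEquiv.commutes] at h2
    exact h2.symm
  have h2 := LinearMap.finrank_range_add_finrank_ker
    ((M - algebraMap ℂ (Matrix n n ℂ) z) ^ k).mulVecLin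
  rw [nullity, h, Matrix.rank]
  simpa [add_comm] using h2

theorem transpose_sub_algebraMap_pow (A : Matrix n n ℂ) (z : ℂ) (j : ℕ) :
    (A.transpose - algebraMap ℂ (Matrix n n ℂ) z) ^ j =
      ((A - algebraMap ℂ (Matrix n n ℂ) z) ^ j).transpose := by
  rw [Matrix.transpose_pow, Matrix.transpose_sub]
  simp [Algebra.algebraMap_eq_smul_one]

theorem nullity_transpose (A : Matrix n n ℂ) (z : ℂ) (j : ℕ) :
    nullity (Matrix.toLin' A.transpose) z j = nullity (Matrix.toLin' A) z j := by
  have h1 := nullity_toLin'_add_rank A z j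
  have h2 := nullity_toLin'_add_rank A.transpose z j
  rw [transpose_sub_algebraMap_pow, Matrix.rank_transpose] at h2
  omega

/-- The nullities of `A` at `z` and of `B` at `w` agree if `A - z` and `B - w` are equal up to a
nonzero scalar and a unit commuting with `A`. -/
theorem nullity_of_mul_eq {A B U : Matrix n n ℂ} {z w c : ℂ} (hU : IsUnit U) (hc : c ≠ 0)
    (h : U * (A - algebraMap ℂ (Matrix n n ℂ) z) = c • (B - algebraMap ℂ (Matrix n n ℂ) w))
    (hUA : Commute U A) (j : ℕ) :
    nullity (Matrix.toLin' A) z j = nullity (Matrix.toLin' B) w j := by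
  have h1 := nullity_toLin'_add_rank A z j
  have h2 := nullity_toLin'_add_rank B w j
  have hcomm : Commute U (A - algebraMap ℂ (Matrix n n ℂ) z) :=
    hUA.sub_right (Algebra.commute_algebraMap_right _ _)
  have h3 := congrArg (fun M => (M ^ j).rank) h
  simp only [hcomm.mul_pow, smul_pow] at h3
  rw [Matrix.rank_mul_eq_right_of_isUnit_det _ _ ((Matrix.isUnit_iff_isUnit_det _).1 (hU.pow j)),
    Matrix.rank_smul_of_mem_nonZeroDivisors _ (by simp [hc])] at h3
  omega

theorem nullity_nonsing_inv {A : Matrix n n ℂ} (hA : IsUnit A) (z : ℂˣ) (j : ℕ) :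
    nullity (Matrix.toLin' A⁻¹) z j = nullity (Matrix.toLin' A) (z⁻¹ : ℂˣ) j := by
  have h1 : A * A⁻¹ = 1 := Matrix.mul_nonsing_inv _ ((Matrix.isUnit_iff_isUnit_det _).1 hA)
  have h2 : A⁻¹ * A = 1 := Matrix.nonsing_inv_mul _ ((Matrix.isUnit_iff_isUnit_det _).1 hA)
  refine nullity_of_mul_eq (U := A) (c := -z) hA (by simp) ?_ (h1.trans h2.symm) j
  rw [mul_sub, h1, smul_sub]
  simp [Algebra.algebraMap_eq_smul_one, smul_smul]
  abel

theorem nullity_fromBlocks {ι κ : Type*} [Fintype ι] [Fintype κ]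
    [DecidableEq ι] [DecidableEq κ] (A : Matrix ι ι ℂ) (B : Matrix κ κ ℂ) (z : ℂ) (j : ℕ) :
    nullity (Matrix.toLin' (Matrix.fromBlocks A 0 0 B)) z j =
      nullity (Matrix.toLin' A) z j + nullity (Matrix.toLin' B) z j := by
  rw [← nullity_prodMap]
  refine nullity_congr (LinearEquiv.sumArrowLequivProdArrow ι κ ℂ ℂ) (fun v => ?_) _ _
  ext i <;> simp [Matrix.mulVec, dotProduct]

end NullityMatrix

section JordanBlock

theorem jordanBlock_apply (k : ℕ) (z : ℂ) (i j : Fin k) : jordanBlock k z i j =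
    (if i = j then z else 0) + (if (i : ℕ) + 1 = j then 1 else 0) := by
  simp only [jordanBlock, Matrix.of_apply]
  by_cases h : i = j
  · subst h; simp
  · simp [h]

/-- Powers of a nilpotent Jordan block shift the coordinates. -/
theorem jordanBlock_sub_pow_apply (k : ℕ) (z : ℂ) (j : ℕ) (v : Fin k → ℂ) (i : Fin k) :
    ((Matrix.toLin' (jordanBlock k z) - algebraMap ℂ (Module.End ℂ (Fin k → ℂ)) z) ^ j) v i =
      if h : (i : ℕ) + j < k then v ⟨i + j, h⟩ else 0 := by
  induction j generalizing v with
  | zero => simp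
  | succ j ih =>
    have h1 (v : Fin k → ℂ) (i : Fin k) : (Matrix.toLin' (jordanBlock k z) -
        algebraMap ℂ (Module.End ℂ (Fin k → ℂ)) z) v i =
        if h : (i : ℕ) + 1 < k then v ⟨i + 1, h⟩ else 0 := by
      simp only [LinearMap.sub_apply, Pi.sub_apply, Matrix.toLin'_apply, Matrix.mulVec, dotProduct,
        jordanBlock_apply, add_mul, Finset.sum_add_distrib]
      simp
      split_ifs with h
      · rw [Finset.sum_eq_single ⟨i + 1, h⟩]
        · simp
        · intro l _ hl
          rw [if_neg]
          exact fun h2 => hl (Fin.ext h2.symm)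
        · simp
      · refine Finset.sum_eq_zero fun l _ => ?_
        rw [if_neg]
        omega
    rw [pow_succ, Module.End.mul_apply, ih]
    simp only [h1]
    by_cases h : (i : ℕ) + (j + 1) < k
    · rw [dif_pos (by omega), dif_pos (by omega), dif_pos h]
      rfl
    · rw [dif_neg h]
      split_ifs <;> first | rfl | omega

theorem isNilpotent_jordanBlock_sub (k : ℕ) (z : ℂ) :
    IsNilpotent (Matrix.toLin' (jordanBlock k z) - algebraMap ℂ (Module.End ℂ (Fin k → ℂ)) z) :=
  ⟨k, LinearMap.ext fun v => funext fun i => by simp [jordanBlock_sub_pow_apply]⟩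

theorem isUnit_jordanBlock (k : ℕ) {z : ℂ} (hz : z ≠ 0) : IsUnit (jordanBlock k z) := by
  have hu : IsUnit (algebraMap ℂ (Module.End ℂ (Fin k → ℂ)) z) := (IsUnit.mk0 _ hz).map _
  have h := (isNilpotent_jordanBlock_sub k z).isUnit_add_left_of_commute hu
    (Algebra.commute_algebraMap_right _ _)
  rw [add_sub_cancel] at h
  have h2 := h.map LinearMap.det
  rwa [LinearMap.det_toLin', ← Matrix.isUnit_iff_isUnit_det] at h2

theorem nullity_jordanBlock (k : ℕ) (z w : ℂ) (j : ℕ) :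
    nullity (Matrix.toLin' (jordanBlock k z)) w j = if z = w then min j k else 0 := by
  split_ifs with h
  · subst h
    have hker : LinearMap.ker ((Matrix.toLin' (jordanBlock k z) -
        algebraMap ℂ (Module.End ℂ (Fin k → ℂ)) z) ^ j) =
        ⨅ i ∈ {i : Fin k | j ≤ i}, LinearMap.ker (LinearMap.proj i : (Fin k → ℂ) →ₗ[ℂ] ℂ) := by
      ext v
      simp only [LinearMap.mem_ker, funext_iff, jordanBlock_sub_pow_apply, Submodule.mem_iInf]
      constructor
      · intro h i hi
        have h2 := h ⟨i - j, by omega⟩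
        have h3 : (i : ℕ) - j + j = i := Nat.sub_add_cancel hi
        simp only [h3] at h2
        simpa using h2
      · intro h i
        split_ifs with hi
        · exact h ⟨i + j, hi⟩ (by simp)
        · rfl
    rw [nullity, hker, (LinearMap.iInfKerProjEquiv ℂ (fun _ : Fin k => ℂ)
      (I := {i : Fin k | (i : ℕ) < j}) (J := {i : Fin k | j ≤ i})
      (by rw [Set.disjoint_left]; intro i; simp)
      (by intro i _; simp [lt_or_ge])).finrank_eq, Module.finrank_fintype_fun_eq_card]
    rw [Fintype.card_subtype]
    exact (Fin.card_filter_val_lt).trans (min_comm _ _)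
  · exact nullity_eq_zero_of_isNilpotent (isNilpotent_jordanBlock_sub k z) h j

end JordanBlock

namespace MultiplicityFunction

variable (μ : MultiplicityFunction)

/-- The dimension of the kernel of `(M - z) ^ j` for a matrix `M` with multiplicity function `μ`: a
block of size `k` with eigenvalue `z` contributes `min j k`. -/
def nul (z : ℂˣ) (j : ℕ) : ℕ := (μ z).sum fun k m => min j (k : ℕ) * m

theorem sum_block {R : Type*} [AddCommMonoid R] (f : ℂˣ → ℕ+ → R) :
    ∑ a : μ.Block, f a.1 a.2.1 =
      Finsupp.sum μ fun z (m : ℕ+ →₀ ℕ) => Finsupp.sum m fun k c => (c • f z k : R) := by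
  simp only [Finsupp.sum]
  rw [Fintype.sum_sigma, ← Finset.sum_coe_sort μ.support]
  refine Finset.sum_congr rfl fun z _ => ?_
  rw [Fintype.sum_sigma, ← Finset.sum_coe_sort (μ z).support]
  refine Finset.sum_congr rfl fun k _ => ?_
  simp

theorem nullity_jordanMatrix_eq_sum (z : ℂ) (j : ℕ) :
    nullity (Matrix.toLin' μ.jordanMatrix) z j =
      ∑ a : μ.Block, nullity (Matrix.toLin' (jordanBlock (a.2.1 : ℕ+) (a.1 : ℂˣ))) z j := by
  rw [← nullity_pi]
  refine nullity_congr (LinearEquiv.piCurry ℂ (fun (a : μ.Block) (_ : Fin (a.2.1 : ℕ+)) => ℂ))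
    (fun v => ?_) _ _
  funext a i
  change ∑ l, jordanBlock _ _ i l * v ⟨a, l⟩ = ∑ x, μ.jordanMatrix ⟨a, i⟩ x * v x
  rw [Fintype.sum_sigma, Finset.sum_eq_single a]
  · simp [jordanMatrix]
  · intro b _ hb
    exact Finset.sum_eq_zero fun l _ => by
      rw [jordanMatrix, Matrix.blockDiagonal'_apply_ne _ _ _ hb.symm, zero_mul]
  · simp

theorem nullity_jordanMatrix (z : ℂˣ) (j : ℕ) :
    nullity (Matrix.toLin' μ.jordanMatrix) z j = μ.nul z j := by
  rw [nullity_jordanMatrix_eq_sum]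
  simp only [nullity_jordanBlock, Units.val_inj]
  rw [sum_block (f := fun z' k => if z' = z then min j (k : ℕ) else 0), nul,
    Finsupp.sum_of_support_subset (s := insert z μ.support) _ (by simp) _ (by simp),
    Finset.sum_eq_single z]
  · simp [mul_comm]
  · intro b _ hb
    simp [hb]
  · simp

theorem trace_jordanMatrix : μ.jordanMatrix.trace = μ.trace := by
  rw [jordanMatrix, Matrix.trace_blockDiagonal']
  have (k : ℕ) (z : ℂ) : (jordanBlock k z).trace = k * z := by
    simp [Matrix.trace, jordanBlock]
  simp only [this]
  rw [sum_block (f := fun z k => ((k : ℕ) : ℂ) * z), trace, Finsupp.sum]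
  refine Finset.sum_congr rfl fun z _ => ?_
  simp only [total, Finsupp.sum, Nat.cast_sum, Finset.sum_mul]
  refine Finset.sum_congr rfl fun k _ => ?_
  simp
  ring

/-- The multiplicities are the negatives of the second differences of the nullities. -/
theorem nul_add_nul (z : ℂˣ) (k : ℕ+) :
    μ z k + μ.nul z (k - 1) + μ.nul z (k + 1) = 2 * μ.nul z k := by
  have h1 : μ z k = (μ z).sum fun l m => (if l = k then 1 else 0) * m := by
    rw [Finsupp.sum_of_support_subset (s := insert k (μ z).support) _ (by simp) _ (by simp),
      Finset.sum_eq_single k]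
    · simp
    · intro b _ hb
      simp [hb]
    · simp
  rw [h1]
  simp only [nul, Finsupp.sum, ← Finset.sum_add_distrib, Finset.mul_sum]
  refine Finset.sum_congr rfl fun l _ => ?_
  rw [← add_mul, ← add_mul, ← mul_assoc]
  congr 1
  have hk := k.pos
  have hl := l.pos
  split_ifs with h
  · subst h; omega
  · have h2 : (l : ℕ) ≠ k := fun h' => h (PNat.coe_injective h')
    omega

theorem ext_nul {μ ν : MultiplicityFunction} (h : ∀ z j, μ.nul z j = ν.nul z j) : μ = ν := by
  ext z k
  have h1 := μ.nul_add_nul z k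
  have h2 := ν.nul_add_nul z k
  simp only [h] at h1
  omega

section IsMultiplicityOf

variable {μ} {N : ℕ} {M : Matrix (Fin N) (Fin N) ℂ}

theorem IsMultiplicityOf.nullity_eq_jordan (h : μ.IsMultiplicityOf M) (z : ℂ) (j : ℕ) :
    nullity (Matrix.toLin' M) z j = nullity (Matrix.toLin' μ.jordanMatrix) z j := by
  obtain ⟨c, hc⟩ := h
  refine nullity_congr c.equivFun (fun v => ?_) z j
  rw [← hc, Matrix.toLin'_apply]
  exact LinearMap.toMatrix_mulVec_repr c c _ v

theorem IsMultiplicityOf.nullity_eq (h : μ.IsMultiplicityOf M) (z : ℂˣ) (j : ℕ) :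
    nullity (Matrix.toLin' M) z j = μ.nul z j :=
  (h.nullity_eq_jordan z j).trans (μ.nullity_jordanMatrix z j)

theorem IsMultiplicityOf.trace_eq (h : μ.IsMultiplicityOf M) : M.trace = μ.trace := by
  obtain ⟨c, hc⟩ := h
  rw [← trace_jordanMatrix, ← hc, ← LinearMap.trace_eq_matrix_trace, Matrix.trace_toLin'_eq]

theorem IsMultiplicityOf.unique {ν : MultiplicityFunction} (h : μ.IsMultiplicityOf M)
    (h' : ν.IsMultiplicityOf M) : μ = ν :=
  ext_nul fun z j => (h.nullity_eq z j).symm.trans (h'.nullity_eq z j)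

theorem IsMultiplicityOf.exists_similar {M' : Matrix (Fin N) (Fin N) ℂ}
    (h : μ.IsMultiplicityOf M) (h' : μ.IsMultiplicityOf M') :
    ∃ S : Matrix (Fin N) (Fin N) ℂ, IsUnit S ∧ S * M' = M * S := by
  obtain ⟨c, hc⟩ := h
  obtain ⟨c', hc'⟩ := h'
  let e : (Fin N → ℂ) ≃ₗ[ℂ] (Fin N → ℂ) := c'.equiv c (Equiv.refl _)
  refine ⟨LinearMap.toMatrix' e.toLinearMap, ?_, ?_⟩
  · rw [Matrix.isUnit_iff_isUnit_det]
    simpa using LinearEquiv.isUnit_det' e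
  · apply Matrix.toLin'.injective
    rw [Matrix.toLin'_mul, Matrix.toLin'_mul, Matrix.toLin'_toMatrix']
    refine c'.ext fun x => ?_
    have h1 : Matrix.toLin' M (c x) = ∑ y, μ.jordanMatrix y x • c y := by
      rw [← hc]
      simp [LinearMap.toMatrix_apply, Module.Basis.sum_repr]
    have h2 : Matrix.toLin' M' (c' x) = ∑ y, μ.jordanMatrix y x • c' y := by
      rw [← hc']
      simp [LinearMap.toMatrix_apply, Module.Basis.sum_repr]
    rw [LinearMap.comp_apply, LinearMap.comp_apply, h2]
    simp only [map_sum, map_smul, LinearEquiv.coe_coe]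
    simp only [e, Module.Basis.equiv_apply, Equiv.refl_apply, h1]

theorem IsMultiplicityOf.card_eq (h : μ.IsMultiplicityOf M) : Fintype.card μ.Index = N := by
  obtain ⟨c, -⟩ := h
  rw [← Module.finrank_eq_card_basis c, Module.finrank_fin_fun]

theorem IsMultiplicityOf.of_similar
    {M' S : Matrix (Fin N) (Fin N) ℂ} (hμ : μ.IsMultiplicityOf M) (hS : IsUnit S)
    (h : S * M' = M * S) : μ.IsMultiplicityOf M' := by
  obtain ⟨c, hc⟩ := hμ
  let e : (Fin N → ℂ) ≃ₗ[ℂ] (Fin N → ℂ) :=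
    Matrix.toLinearEquiv' S (hS.invertible)
  have he (v : Fin N → ℂ) : e v = S.mulVec v := rfl
  refine ⟨c.map e.symm, ?_⟩
  rw [← hc]
  ext i j
  rw [LinearMap.toMatrix_apply, LinearMap.toMatrix_apply, Module.Basis.map_repr,
    LinearEquiv.trans_apply, LinearEquiv.symm_symm, Module.Basis.map_apply, he,
    Matrix.toLin'_apply, Matrix.toLin'_apply, Matrix.mulVec_mulVec, h, ← Matrix.mulVec_mulVec,
    ← he, LinearEquiv.apply_symm_apply]

end IsMultiplicityOf

end MultiplicityFunction

/-! ### The Jordan normal form -/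

open Polynomial in
/-- On `ℂ[X] / (X - z) ^ n`, multiplication by `X` is a Jordan block in the basis of the powers
`(X - z) ^ (n - 1 - j)`. -/
theorem exists_jordanBasis_quotient {p : ℂ[X]} (hp : Irreducible p) (n : ℕ) :
    ∃ (z : ℂ) (b : Module.Basis (Fin n) ℂ (ℂ[X] ⧸ Submodule.span ℂ[X] {p ^ n})),
      ∀ j, (X : ℂ[X]) • b j = ∑ l, jordanBlock n z l j • b l := by
  obtain ⟨z, hz⟩ : ∃ z, Associated (X - C z) p := by
    obtain ⟨z, hz⟩ := IsAlgClosed.exists_root p (degree_pos_of_irreducible hp).ne'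
    exact ⟨z, (irreducible_X_sub_C z).associated_of_dvd hp (dvd_iff_isRoot.2 hz)⟩
  have hspan : Submodule.span ℂ[X] {p ^ n} = Submodule.span ℂ[X] {(X - C z) ^ n} :=
    Ideal.span_singleton_eq_span_singleton.2 hz.symm.pow_pow
  rw [hspan]
  set Q := ℂ[X] ⧸ Submodule.span ℂ[X] {(X - C z) ^ n}
  let v : Fin n → Q := fun j => Submodule.Quotient.mk ((X - C z) ^ (n - 1 - j : ℕ))
  have hli : LinearIndependent ℂ v := by
    rw [Fintype.linearIndependent_iff]
    intro c hc j
    have h1 : (Submodule.Quotient.mk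
        (∑ l : Fin n, C (c l) * (X - C z) ^ (n - 1 - l : ℕ)) : Q) = 0 := by
      rw [← hc]
      change Submodule.mkQ _ _ = _
      rw [map_sum]
      refine Finset.sum_congr rfl fun l _ => ?_
      rw [← smul_eq_C_mul]
      rfl
    rw [Submodule.Quotient.mk_eq_zero] at h1
    have h2 := Ideal.mem_span_singleton.1 h1
    -- substitute `X + z` for `X`, so that coefficients can be compared
    have h3 : (X : ℂ[X]) ^ n ∣ ∑ l : Fin n, C (c l) * X ^ (n - 1 - l : ℕ) := by
      have h := map_dvd (compRingHom (X + C z)) h2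
      simpa using h
    have h4 := X_pow_dvd_iff.1 h3 (n - 1 - j) (by omega)
    simp only [finsetSum_coeff, coeff_C_mul_X_pow] at h4
    rw [Finset.sum_eq_single j] at h4
    · simpa using h4
    · intro l _ hl
      rw [if_neg]
      intro h
      exact hl (Fin.ext (by omega))
    · simp
  have hfin : Fintype.card (Fin n) = Module.finrank ℂ Q := by
    have h := finrank_quotient_span_eq_natDegree (f := (X - C z) ^ n)
    rw [natDegree_pow, natDegree_X_sub_C, mul_one] at h
    rw [Fintype.card_fin]
    exact h.symm
  have hb : ∃ b : Module.Basis (Fin n) ℂ Q, ⇑b = v := by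
    rcases Nat.eq_zero_or_pos n with h0 | h0
    · subst h0
      have : Subsingleton Q := by
        rw [Submodule.Quotient.subsingleton_iff, pow_zero]
        exact Ideal.span_singleton_one
      exact ⟨Module.Basis.empty Q, funext fun j => j.elim0⟩
    · have : Nonempty (Fin n) := ⟨⟨0, h0⟩⟩
      exact ⟨basisOfLinearIndependentOfCardEqFinrank hli hfin,
        coe_basisOfLinearIndependentOfCardEqFinrank _ _⟩
  obtain ⟨b, hb⟩ := hb
  refine ⟨z, b, fun j => ?_⟩
  have h1 : (X : ℂ[X]) • b j = z • b j + (X - C z) • b j := by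
    rw [← algebraMap_smul ℂ[X] z (b j), ← add_smul, algebraMap_eq, add_sub_cancel]
  rw [h1]
  simp only [jordanBlock_apply, add_smul, Finset.sum_add_distrib, ite_smul, zero_smul, one_smul,
    Finset.sum_ite_eq', Finset.mem_univ, if_true, hb]
  congr 1
  change Submodule.Quotient.mk ((X - C z) * (X - C z) ^ (n - 1 - j : ℕ)) = _
  rw [← pow_succ']
  rcases Nat.eq_zero_or_pos (j : ℕ) with h0 | h0
  · rw [Finset.sum_eq_zero fun l _ => if_neg (by omega), Submodule.Quotient.mk_eq_zero]
    refine Ideal.mem_span_singleton.2 (pow_dvd_pow _ (by omega))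
  · rw [Finset.sum_eq_single ⟨j - 1, by omega⟩]
    · rw [if_pos (Nat.sub_add_cancel h0)]
      have h3 : n - 1 - (j : ℕ) + 1 = n - 1 - (j - 1 : ℕ) := by omega
      rw [h3]
    · intro l _ hl
      exact if_neg fun h => hl (Fin.ext (by simp; omega))
    · simp

theorem dfinsupp_basis_apply {ι : Type*} [DecidableEq ι] {M : ι → Type*} [∀ i, AddCommMonoid (M i)]
    [∀ i, Module ℂ (M i)] {η : ι → Type*} (b : ∀ i, Module.Basis (η i) ℂ (M i)) (i : ι) (j : η i) :
    DFinsupp.basis b ⟨i, j⟩ = DFinsupp.single i (b i j) := by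
  rw [Module.Basis.apply_eq_iff]
  change (sigmaFinsuppLequivDFinsupp ℂ).symm (DFinsupp.mapRange.linearEquiv _ _) = _
  rw [LinearEquiv.symm_apply_eq]
  simp

open Polynomial in
/-- The Jordan normal form, from the structure theorem for torsion modules over `ℂ[X]`.  Blocks of
size `0` are allowed. -/
theorem exists_jordanBasis {V : Type*} [AddCommGroup V] [Module ℂ V] [Module.Finite ℂ V]
    (f : Module.End ℂ V) :
    ∃ (ι : Type) (_ : Fintype ι) (z : ι → ℂ) (n : ι → ℕ) (c : Module.Basis (Σ i, Fin (n i)) ℂ V),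
      ∀ i j, f (c ⟨i, j⟩) = ∑ l, jordanBlock (n i) (z i) l j • c ⟨i, l⟩ := by
  classical
  obtain ⟨ι, hι, p, hp, n, ⟨e⟩⟩ := Module.equiv_directSum_of_isTorsion
    (Module.AEval.isTorsion_of_finiteDimensional ℂ V f)
  choose z b hb using fun i => exists_jordanBasis_quotient (hp i) (n i)
  let c : Module.Basis (Σ i, Fin (n i)) ℂ V :=
    (DFinsupp.basis b).map ((e.restrictScalars ℂ).symm ≪≫ₗ (Module.AEval'.of f).symm)
  have hc (i j) : c ⟨i, j⟩ =
      (Module.AEval'.of f).symm (e.symm (DirectSum.lof ℂ[X] ι _ i (b i j))) := by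
    rw [Module.Basis.map_apply, dfinsupp_basis_apply]
    rfl
  refine ⟨ι, hι, z, n, c, fun i j => ?_⟩
  rw [hc, ← Module.AEval'.of_symm_X_smul, ← map_smul, ← map_smul, hb]
  simp only [map_sum, hc]
  refine Finset.sum_congr rfl fun l _ => ?_
  rw [← algebraMap_smul ℂ[X] (jordanBlock (n i) (z i) l j) (b i l), map_smul, map_smul,
    algebraMap_smul, map_smul]

/-- Every invertible matrix has a multiplicity function: its nonempty Jordan blocks are sorted by
eigenvalue and size. -/
theorem exists_isMultiplicityOf {N : ℕ} {M : Matrix (Fin N) (Fin N) ℂ} (hM : IsUnit M) :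
    ∃ μ : MultiplicityFunction, μ.IsMultiplicityOf M := by
  classical
  obtain ⟨ι, _, z, n, c, hc⟩ := exists_jordanBasis (Matrix.toLin' M)
  have hinj : Function.Injective (Matrix.toLin' M) := by
    intro v w h
    exact Matrix.mulVec_injective_of_isUnit hM (by simpa using h)
  -- an eigenvalue `0` would put the first basis vector of its block into the kernel
  have hz (i : {i // n i ≠ 0}) : z i ≠ 0 := by
    intro h0
    have h1 := hc i ⟨0, Nat.pos_of_ne_zero i.2⟩
    have h2 : ∀ l, jordanBlock (n i) (z i) l ⟨0, Nat.pos_of_ne_zero i.2⟩ = 0 := by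
      intro l
      simp [jordanBlock, h0]
    simp only [h2, zero_smul, Finset.sum_const_zero] at h1
    rw [← map_zero (Matrix.toLin' M)] at h1
    exact c.ne_zero _ (hinj h1)
  let zU (i : {i // n i ≠ 0}) : ℂˣ := Units.mk0 (z i) (hz i)
  let nP (i : {i // n i ≠ 0}) : ℕ+ := ⟨n i, Nat.pos_of_ne_zero i.2⟩
  let μ : MultiplicityFunction := ∑ i, Finsupp.single (zU i) (Finsupp.single (nP i) 1)
  have hμ (w : ℂˣ) (k : ℕ+) : μ w k = Fintype.card {i // zU i = w ∧ nP i = k} := by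
    simp only [μ, Finsupp.finsetSum_apply]
    rw [Fintype.card_subtype, Finset.card_filter]
    refine Finset.sum_congr rfl fun i _ => ?_
    by_cases h : zU i = w
    · simp [h, Finsupp.single_apply]
    · simp [h]
  -- `g` matches the blocks prescribed by `μ` with the nonempty blocks of the Jordan basis
  let E (w : ℂˣ) (k : ℕ+) : Fin (μ w k) ≃ {i // zU i = w ∧ nP i = k} :=
    (finCongr (hμ w k)).trans (Fintype.equivFin _).symm
  let g (a : μ.Block) : {i // n i ≠ 0} := (E a.1 a.2.1 a.2.2).1
  have hg1 (a : μ.Block) : zU (g a) = a.1 := (E a.1 a.2.1 a.2.2).2.1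
  have hg2 (a : μ.Block) : nP (g a) = a.2.1 := (E a.1 a.2.1 a.2.2).2.2
  have hg2' (a : μ.Block) : ((a.2.1 : ℕ+) : ℕ) = n (g a) := by rw [← hg2]; rfl
  have hg : Function.Bijective g := by
    constructor
    · rintro ⟨⟨w, hw⟩, ⟨k, hk⟩, t⟩ ⟨⟨w', hw'⟩, ⟨k', hk'⟩, t'⟩ h
      have h1 : w = w' :=
        (hg1 _).symm.trans ((congrArg zU h).trans (hg1 _))
      subst h1
      have h2 : k = k' :=
        (hg2 _).symm.trans ((congrArg nP h).trans (hg2 _))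
      subst h2
      have h3 : t = t' := (E w k).injective (Subtype.ext h)
      subst h3
      rfl
    · intro i
      let t := (E (zU i) (nP i)).symm ⟨i, rfl, rfl⟩
      have ht : E (zU i) (nP i) t = ⟨i, rfl, rfl⟩ := Equiv.apply_symm_apply _ _
      have hpos : μ (zU i) (nP i) ≠ 0 := fun h => (Fin.cast h t).elim0
      refine ⟨⟨⟨zU i, ?_⟩, ⟨nP i, ?_⟩, t⟩, ?_⟩
      · rw [Finsupp.mem_support_iff]
        intro h
        rw [h] at hpos
        exact hpos rfl
      · rwa [Finsupp.mem_support_iff]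
      · exact congrArg Subtype.val ht
  let G (x : μ.Index) : Σ i, Fin (n i) := ⟨g x.1, Fin.cast (hg2' x.1) x.2⟩
  have hG : Function.Bijective G := by
    constructor
    · rintro ⟨a, i⟩ ⟨b, j⟩ h
      have h1 : a = b := hg.1 (Subtype.ext (congrArg Sigma.fst h))
      subst h1
      have h2 := eq_of_heq (Sigma.mk.inj_iff.1 h).2
      have h3 : i = j := Fin.ext (by simpa [Fin.ext_iff] using h2)
      rw [h3]
    · rintro ⟨i, j⟩
      obtain ⟨a, ha⟩ := hg.2 ⟨i, fun h => (Fin.cast h j).elim0⟩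
      obtain rfl : (g a : ι) = i := congrArg Subtype.val ha
      exact ⟨⟨a, Fin.cast (hg2' a).symm j⟩, rfl⟩
  let c' : Module.Basis μ.Index ℂ (Fin N → ℂ) := c.reindex (Equiv.ofBijective G hG).symm
  have hc' (a : μ.Block) (j) : c' ⟨a, j⟩ = c ⟨g a, Fin.cast (hg2' a) j⟩ := by
    simp [c', G]
  have key (a : μ.Block) (j) : Matrix.toLin' M (c' ⟨a, j⟩) =
      ∑ l, jordanBlock (a.2.1 : ℕ+) (a.1 : ℂˣ) l j • c' ⟨a, l⟩ := by
    simp only [hc']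
    rw [hc, ← (finCongr (hg2' a)).sum_comp]
    refine Finset.sum_congr rfl fun l _ => ?_
    congr 1
    have hza : z (g a) = (a.1 : ℂˣ) := congrArg Units.val (hg1 a)
    simp [jordanBlock, hza]
  refine ⟨μ, c', ?_⟩
  ext ⟨a, i⟩ ⟨b, j⟩
  rw [LinearMap.toMatrix_apply, key]
  simp only [map_sum, map_smul, Module.Basis.repr_self, Finsupp.finsetSum_apply, Finsupp.smul_apply,
    smul_eq_mul, MultiplicityFunction.jordanMatrix]
  by_cases h : a = b
  · subst h
    rw [Matrix.blockDiagonal'_apply_eq, Finset.sum_eq_single i]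
    · simp
    · intro l _ hl
      rw [Finsupp.single_eq_of_ne (by simpa using hl.symm), mul_zero]
    · simp
  · rw [Matrix.blockDiagonal'_apply_ne _ _ _ h]
    refine Finset.sum_eq_zero fun l _ => ?_
    rw [Finsupp.single_eq_of_ne (fun h' => h (congrArg Sigma.fst h')), mul_zero]

/-! ### Symmetry and parity of the multiplicities of an asymmetry -/

section Asymmetry

variable {n : Type*} [Fintype n] [DecidableEq n]

omit [DecidableEq n] in
/-- A skew-symmetric matrix has even rank: on a complement of its kernel it restricts to a
skew-symmetric matrix with nonzero determinant. -/
theorem even_rank_of_transpose_eq_neg {K : Matrix n n ℂ} (hK : K.transpose = -K) :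
    Even K.rank := by
  obtain ⟨W, hW⟩ := Submodule.exists_isCompl (LinearMap.ker K.mulVecLin)
  let w := Module.finBasis ℂ W
  set r := Module.finrank ℂ W with hr
  have hrank : K.rank = r := by
    have h1 := Submodule.finrank_add_eq_of_isCompl hW
    have h2 := LinearMap.finrank_range_add_finrank_ker K.mulVecLin
    rw [Matrix.rank]
    omega
  let P : Matrix n (Fin r) ℂ := Matrix.of fun i j => (w j : n → ℂ) i
  have hP (c : Fin r → ℂ) : P.mulVec c = ((∑ j, c j • w j : W) : n → ℂ) := by
    ext i
    simp [P, Matrix.mulVec, dotProduct, mul_comm]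
  let G : Matrix (Fin r) (Fin r) ℂ := P.transpose * K * P
  have hG : G.transpose = -G := by
    simp [G, Matrix.transpose_mul, hK, Matrix.mul_assoc]
  have hdet : G.det ≠ 0 := by
    intro h0
    obtain ⟨c, hc0, hc⟩ := Matrix.exists_mulVec_eq_zero_iff.2 h0
    set u : W := ∑ j, c j • w j with hu
    have hc' : P.transpose.mulVec (K.mulVec u) = 0 := by
      rw [← hc, ← hP]
      simp [G, Matrix.mulVec_mulVec, Matrix.mul_assoc]
    have hperp : ∀ x : n → ℂ, x ⬝ᵥ K.mulVec u = 0 := by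
      intro x
      have hx : x ∈ LinearMap.ker K.mulVecLin ⊔ W := by rw [hW.sup_eq_top]; trivial
      obtain ⟨y, hy, v, hv, rfl⟩ := Submodule.mem_sup.1 hx
      rw [add_dotProduct]
      have h1 : y ⬝ᵥ K.mulVec u = 0 := by
        have hy : K.mulVec y = 0 := hy
        rw [Matrix.dotProduct_mulVec, ← Matrix.mulVec_transpose, hK, Matrix.neg_mulVec, hy]
        simp
      have h2 : v ⬝ᵥ K.mulVec u = 0 := by
        obtain ⟨a, ha⟩ : ∃ a, P.mulVec a = v :=
          ⟨w.repr ⟨v, hv⟩, by rw [hP, w.sum_repr]⟩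
        rw [← ha, dotProduct_comm, Matrix.dotProduct_mulVec, ← Matrix.mulVec_transpose, hc']
        simp
      rw [h1, h2, add_zero]
    have hKu : K.mulVec u = 0 :=
      dotProduct_eq_zero _ fun x => (dotProduct_comm _ _).trans (hperp x)
    have hu0 : u = 0 := by
      have h := (Submodule.disjoint_def.1 hW.disjoint) (u : n → ℂ) hKu u.2
      exact Subtype.ext h
    refine hc0 (funext fun j => ?_)
    exact Fintype.linearIndependent_iff.1 w.linearIndependent c (hu ▸ hu0) j
  rw [hrank]
  by_contra hodd
  rw [Nat.not_even_iff_odd] at hodd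
  have h := congrArg Matrix.det hG
  rw [Matrix.det_transpose, Matrix.det_neg, Fintype.card_fin, hodd.neg_one_pow] at h
  exact hdet (self_eq_neg.1 (by simpa using h))

variable {E T : Matrix n n ℂ}

/-- The asymmetry `T` is an isometry of `E`, that is, `ᵗT * E * T = E`; hence the transpose of
`T - z` corresponds to `T - z⁻¹` under the form `E`. -/
theorem transpose_sub_pow_mul (hT : E * T = E.transpose) {z w : ℂ} (hzw : z * w = 1) (k : ℕ) :
    (T.transpose - algebraMap ℂ (Matrix n n ℂ) z) ^ k * (E * T ^ k) =
      (-z) ^ k • (E * (T - algebraMap ℂ (Matrix n n ℂ) w) ^ k) := by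
  have h1 : (T.transpose - algebraMap ℂ (Matrix n n ℂ) z) * (E * T) =
      (-z) • (E * (T - algebraMap ℂ (Matrix n n ℂ) w)) := by
    have h2 : T.transpose * E.transpose = E := by
      rw [← Matrix.transpose_mul, hT, Matrix.transpose_transpose]
    simp only [sub_mul, mul_sub, Algebra.algebraMap_eq_smul_one, Matrix.mul_smul, Matrix.smul_mul,
      mul_one, one_mul, smul_sub, smul_smul]
    rw [neg_mul, hzw, hT, h2, ← hT, neg_smul, neg_one_smul, sub_neg_eq_add, sub_eq_neg_add]
  induction k with
  | zero => simp
  | succ k ih =>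
    have hc : Commute (T - algebraMap ℂ (Matrix n n ℂ) w) (T ^ k) :=
      ((Commute.refl T).sub_left (Algebra.commute_algebraMap_left _ _)).pow_right k
    calc _ = (T.transpose - algebraMap ℂ (Matrix n n ℂ) z) ^ k *
          ((T.transpose - algebraMap ℂ (Matrix n n ℂ) z) * (E * T)) * T ^ k := by
            rw [pow_succ, pow_succ']; simp only [mul_assoc]
      _ = (-z) • ((T.transpose - algebraMap ℂ (Matrix n n ℂ) z) ^ k * (E * T ^ k) *
          (T - algebraMap ℂ (Matrix n n ℂ) w)) := by
            rw [h1]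
            simp only [Matrix.mul_smul, Matrix.smul_mul, mul_assoc]
            rw [hc.eq]
      _ = _ := by
            rw [ih, Matrix.smul_mul, smul_smul, ← pow_succ', mul_assoc, ← pow_succ]

theorem nullity_inv (hE : IsUnit E) (hTu : IsUnit T) (hT : E * T = E.transpose) (z : ℂˣ) (k : ℕ) :
    nullity (Matrix.toLin' T) z k = nullity (Matrix.toLin' T) (z⁻¹ : ℂˣ) k := by
  have h := congrArg Matrix.rank (transpose_sub_pow_mul hT (z.mul_inv) k)
  have hu : IsUnit (E * T ^ k) := hE.mul (hTu.pow k)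
  rw [Matrix.rank_mul_eq_left_of_isUnit_det _ _ ((Matrix.isUnit_iff_isUnit_det _).1 hu),
    Matrix.rank_smul_of_mem_nonZeroDivisors _ (by simp),
    Matrix.rank_mul_eq_right_of_isUnit_det _ _ ((Matrix.isUnit_iff_isUnit_det _).1 hE)] at h
  rw [transpose_sub_algebraMap_pow, Matrix.rank_transpose] at h
  have h1 := nullity_toLin'_add_rank T z k
  have h2 := nullity_toLin'_add_rank T (z⁻¹ : ℂˣ) k
  omega

/-- For `z = ±1`, the matrix `(T - z) ^ (2 * m) * (T - 1)` has the rank of a skew-symmetric matrix,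
namely of `ᵗ(T - z) ^ m * (ᵗE - E) * (T - z) ^ m`. -/
theorem even_rank_sub_pow_mul (hTu : IsUnit T) (hE : IsUnit E) (hT : E * T = E.transpose) {z : ℂ}
    (hz : z * z = 1) (m : ℕ) :
    Even ((T - algebraMap ℂ (Matrix n n ℂ) z) ^ (2 * m) * (T - 1)).rank := by
  set A := T - algebraMap ℂ (Matrix n n ℂ) z with hA
  have h := transpose_sub_pow_mul hT hz m
  rw [transpose_sub_algebraMap_pow, ← hA] at h
  have hAT : Commute A T := (Commute.refl T).sub_left (Algebra.commute_algebraMap_left _ _)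
  have hA1 : Commute A (T - 1) := hAT.sub_right (Commute.one_right _)
  have hT1 : Commute T (T - 1) := (Commute.refl T).sub_right (Commute.one_right _)
  let S := (A ^ m).transpose * (E.transpose - E) * A ^ m
  have hS : S.transpose = -S := by
    simp only [S, Matrix.transpose_mul, Matrix.transpose_transpose, Matrix.transpose_sub]
    rw [← neg_sub E.transpose E, Matrix.neg_mul, Matrix.mul_neg, Matrix.mul_assoc]
  have hST : S * T ^ m = (-z) ^ m • (E * (A ^ (2 * m) * (T - 1))) := by
    have h1 : E.transpose - E = E * (T - 1) := by rw [mul_sub, hT, mul_one]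
    have hc : (T - 1) * (A ^ m * T ^ m) = T ^ m * (A ^ m * (T - 1)) := by
      rw [← mul_assoc, (hA1.pow_left m).symm.eq, mul_assoc, (hT1.symm.pow_right m).eq, ← mul_assoc,
        (hAT.pow_pow m m).eq, mul_assoc]
    calc S * T ^ m = (A ^ m).transpose * E * ((T - 1) * (A ^ m * T ^ m)) := by
          simp only [S, h1, mul_assoc]
      _ = (A ^ m).transpose * (E * T ^ m) * (A ^ m * (T - 1)) := by
          rw [hc]
          simp only [mul_assoc]
      _ = _ := by
          rw [h, Matrix.smul_mul, mul_assoc, ← mul_assoc (A ^ m), ← pow_add, two_mul]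
  have hr := congrArg Matrix.rank hST
  have hz0 : z ≠ 0 := by rintro rfl; simp at hz
  rw [Matrix.rank_mul_eq_left_of_isUnit_det _ _ ((Matrix.isUnit_iff_isUnit_det _).1 (hTu.pow m)),
    Matrix.rank_smul_of_mem_nonZeroDivisors _ (by simp [hz0]),
    Matrix.rank_mul_eq_right_of_isUnit_det _ _ ((Matrix.isUnit_iff_isUnit_det _).1 hE)] at hr
  rw [← hr]
  exact even_rank_of_transpose_eq_neg hS

open Polynomial in
/-- The kernel of `(T + 1) ^ (2 * m) * (T - 1)` is the direct sum of the kernels of the two coprime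
factors, and the ranks of this product and of `T - 1` are even. -/
theorem even_nullity_neg_one (hTu : IsUnit T) (hE : IsUnit E) (hT : E * T = E.transpose) (m : ℕ) :
    Even (nullity (Matrix.toLin' T) (-1) (2 * m)) := by
  have h1 := even_rank_sub_pow_mul hTu hE hT (z := -1) (by norm_num) m
  have h2 := even_rank_sub_pow_mul hTu hE hT (z := -1) (by norm_num) 0
  rw [mul_zero, pow_zero, one_mul] at h2
  set f := Matrix.toLin' T
  let p : ℂ[X] := (X + 1) ^ (2 * m)
  let q : ℂ[X] := X - 1
  have hpq : IsCoprime p q := by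
    refine IsCoprime.pow_left ⟨C (1 / 2), -C (1 / 2), ?_⟩
    have : (C (1 / 2) : ℂ[X]) * 2 = 1 := by
      rw [← map_ofNat C 2, ← C_mul]; norm_num
    linear_combination this
  have hp : aeval f p = (f - algebraMap ℂ (Module.End ℂ (n → ℂ)) (-1)) ^ (2 * m) := by
    simp [p]
  have hker := Polynomial.sup_ker_aeval_eq_ker_aeval_mul_of_coprime f hpq
  have hdis := Polynomial.disjoint_ker_aeval_of_isCoprime f hpq
  have hdim := Submodule.finrank_sup_add_finrank_inf_eq (LinearMap.ker (aeval f p))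
    (LinearMap.ker (aeval f q))
  rw [hdis.eq_bot, finrank_bot, add_zero, hker] at hdim
  have e1 : aeval f (p * q) =
      ((T - algebraMap ℂ (Matrix n n ℂ) (-1)) ^ (2 * m) * (T - 1)).mulVecLin := by
    have h := Polynomial.aeval_algHom_apply (Matrix.toLinAlgEquiv' (R := ℂ) (n := n)) T (p * q)
    refine h.trans (congrArg (Matrix.toLinAlgEquiv' (R := ℂ) (n := n)) ?_)
    simp [p, q]
  have e2 : aeval f q = (T - 1).mulVecLin := by
    have h := Polynomial.aeval_algHom_apply (Matrix.toLinAlgEquiv' (R := ℂ) (n := n)) T q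
    refine h.trans (congrArg (Matrix.toLinAlgEquiv' (R := ℂ) (n := n)) ?_)
    simp [q]
  have r1 := LinearMap.finrank_range_add_finrank_ker
    ((T - algebraMap ℂ (Matrix n n ℂ) (-1)) ^ (2 * m) * (T - 1)).mulVecLin
  have r2 := LinearMap.finrank_range_add_finrank_ker (T - 1).mulVecLin
  rw [e1, e2, hp] at hdim
  rw [nullity]
  rw [Matrix.rank] at h1 h2
  rw [Nat.even_iff] at *
  omega

end Asymmetry

/-- The multiplicities are, up to sign, second differences of nullities, so the parity conditions
follow from `even_rank_sub_pow_mul` and `even_nullity_neg_one`. -/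
theorem isAdmissible_of_isMultiplicityOf {N : ℕ} {E : Matrix (Fin N) (Fin N) ℂ} (hE : IsUnit E)
    {μ : MultiplicityFunction} (h : μ.IsMultiplicityOf (Θ E)) : μ.IsAdmissible := by
  have hT : E * Θ E = E.transpose := by
    rw [Θ, ← mul_assoc, Matrix.mul_nonsing_inv _ ((Matrix.isUnit_iff_isUnit_det _).1 hE), one_mul]
  have hTu : IsUnit (Θ E) := isUnit_theta hE
  have hinv (z : ℂˣ) (j : ℕ) : μ.nul z j = μ.nul z⁻¹ j := by
    rw [← h.nullity_eq, ← h.nullity_eq, nullity_inv hE hTu hT]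
  refine ⟨fun z => ?_, fun k hk => ?_, fun k hk => ?_⟩
  · ext k
    have h1 := μ.nul_add_nul z k
    have h2 := μ.nul_add_nul z⁻¹ k
    simp only [hinv z] at h1
    omega
  · have h1 := μ.nul_add_nul 1 k
    have key (j : ℕ) (hj : Odd j) : Even (N - μ.nul 1 j) ∧ μ.nul 1 j ≤ N := by
      obtain ⟨m, rfl⟩ := hj
      have h2 := even_rank_sub_pow_mul hTu hE hT (z := 1) (by norm_num) m
      have h3 := nullity_toLin'_add_rank (Θ E) 1 (2 * m + 1)
      have h4 := h.nullity_eq 1 (2 * m + 1)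
      rw [Units.val_one] at h4
      rw [h4, map_one, pow_succ, Fintype.card_fin] at h3
      rw [map_one] at h2
      rw [← h3]
      simpa using h2
    obtain ⟨a1, b1⟩ := key (k - 1) (Nat.Even.sub_odd k.pos hk odd_one)
    obtain ⟨a2, b2⟩ := key (k + 1) hk.add_one
    rw [Nat.even_iff] at *
    omega
  · have h1 := μ.nul_add_nul (-1) k
    have key (j : ℕ) (hj : Even j) : Even (μ.nul (-1) j) := by
      obtain ⟨m, rfl⟩ := hj.two_dvd
      have h2 := even_nullity_neg_one hTu hE hT m
      have h4 := h.nullity_eq (-1) (2 * m)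
      rw [Units.val_neg, Units.val_one] at h4
      rwa [← h4]
    have a1 := key (k - 1) (Nat.Odd.sub_odd hk odd_one)
    have a2 := key (k + 1) hk.add_one
    rw [Nat.even_iff] at *
    omega

/-! ### Realizing admissible multiplicity functions -/

namespace MultiplicityFunction

/-- `μ` is realizable if some invertible `E`, of any finite size, has an asymmetry `T = E⁻¹ * ᵗE`
with the nullities prescribed by `μ`. -/
def Realizable (μ : MultiplicityFunction) : Prop :=
  ∃ (ι : Type) (_ : Fintype ι) (_ : DecidableEq ι) (E T : Matrix ι ι ℂ), IsUnit E ∧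
    E * T = E.transpose ∧ ∀ (z : ℂˣ) (j : ℕ), nullity (Matrix.toLin' T) z j = μ.nul z j

theorem nul_zero (z : ℂˣ) (j : ℕ) : nul 0 z j = 0 := by simp [nul]

theorem nul_add (μ ν : MultiplicityFunction) (z : ℂˣ) (j : ℕ) :
    (μ + ν).nul z j = μ.nul z j + ν.nul z j := by
  rw [nul, Finsupp.add_apply, Finsupp.sum_add_index']
  · rfl
  · simp
  · intro k a b; ring

/-- The multiplicity function of a single Jordan block. -/
noncomputable def block (z : ℂˣ) (k : ℕ+) : MultiplicityFunction :=
  Finsupp.single z (Finsupp.single k 1)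

theorem block_apply (z w : ℂˣ) (k l : ℕ+) : block z k w l = if z = w ∧ k = l then 1 else 0 := by
  by_cases h : z = w
  · simp [block, h, Finsupp.single_apply]
  · simp [block, h]

theorem nul_block (z w : ℂˣ) (k : ℕ+) (j : ℕ) :
    (block z k).nul w j = if z = w then min j (k : ℕ) else 0 := by
  by_cases h : z = w
  · simp [nul, block, h]
  · simp [nul, block, h]

theorem realizable_zero : Realizable 0 := by
  refine ⟨Empty, inferInstance, inferInstance, 1, 1, isUnit_one, by simp, fun z j => ?_⟩
  rw [nul_zero]
  exact Nat.eq_zero_of_add_eq_zero_right (nullity_toLin'_add_rank _ _ _)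

theorem Realizable.add {μ ν : MultiplicityFunction} (hμ : μ.Realizable) (hν : ν.Realizable) :
    (μ + ν).Realizable := by
  obtain ⟨ι, _, _, E, T, hE, hT, h⟩ := hμ
  obtain ⟨κ, _, _, E', T', hE', hT', h'⟩ := hν
  refine ⟨ι ⊕ κ, inferInstance, inferInstance, Matrix.fromBlocks E 0 0 E',
    Matrix.fromBlocks T 0 0 T', ?_, ?_, fun z j => ?_⟩
  · rw [Matrix.isUnit_iff_isUnit_det] at *
    rw [Matrix.det_fromBlocks_zero₂₁]
    exact hE.mul hE'
  · simp [Matrix.fromBlocks_multiply, Matrix.fromBlocks_transpose, hT, hT']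
  · rw [nul_add, ← h, ← h', nullity_fromBlocks]

/-- A pair of blocks with eigenvalues `z` and `z⁻¹` is realized by a form for which two totally
isotropic subspaces are in duality. -/
theorem realizable_pair (z : ℂˣ) (k : ℕ+) : (block z k + block z⁻¹ k).Realizable := by
  set A := (jordanBlock k z).transpose with hA
  have hAu : IsUnit A := (Matrix.isUnit_transpose _).2 (isUnit_jordanBlock k z.ne_zero)
  have h1 : A * A⁻¹ = 1 := Matrix.mul_nonsing_inv _ ((Matrix.isUnit_iff_isUnit_det _).1 hAu)
  have h2 : A⁻¹ * A = 1 := Matrix.nonsing_inv_mul _ ((Matrix.isUnit_iff_isUnit_det _).1 hAu)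
  refine ⟨Fin k ⊕ Fin k, inferInstance, inferInstance, Matrix.fromBlocks 0 1 A 0,
    Matrix.fromBlocks A⁻¹ 0 0 A.transpose, ?_, ?_, fun w j => ?_⟩
  · refine IsUnit.of_mul_eq_one_right (Matrix.fromBlocks 0 A⁻¹ 1 0) ?_
    simp [Matrix.fromBlocks_multiply, h2]
  · simp [Matrix.fromBlocks_multiply, Matrix.fromBlocks_transpose, h1]
  · rw [nullity_fromBlocks, nullity_nonsing_inv hAu, hA, Matrix.transpose_transpose,
      nullity_transpose, nullity_jordanBlock, nullity_jordanBlock, nul_add, nul_block, nul_block,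
      add_comm]
    simp only [Units.val_inj, inv_eq_iff_eq_inv (a := z) (b := w)]

/-- A block of size `k` with eigenvalue `z = (-1) ^ (k - 1)`.  Let `S` be the nilpotent Jordan block
and `P` the alternating antidiagonal matrix, so that `ᵗP = z • P` and `P * S = -ᵗS * P`.  The matrix
`P * (1 - S)` has the Cayley transform `z • (1 - S)⁻¹ * (1 + S)` as its asymmetry, which is a single
block because `(1 - S) * (T - z) = 2 * z • S`. -/
theorem realizable_block {z : ℂˣ} {k : ℕ+} (hz : (z : ℂ) = (-1) ^ ((k : ℕ) - 1)) :
    (block z k).Realizable := by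
  let S := jordanBlock k 0
  let P : Matrix (Fin k) (Fin k) ℂ :=
    Matrix.of fun i j => if j = Fin.rev i then (-1) ^ (i : ℕ) else 0
  have hsign (i : Fin k) : (z : ℂ) * (-1) ^ (Fin.rev i : ℕ) = (-1) ^ (i : ℕ) := by
    have h3 : (k : ℕ) - 1 = i + Fin.rev i := by rw [Fin.val_rev]; omega
    rw [hz, h3, pow_add, mul_assoc, ← mul_pow]
    simp
  have hPt : P.transpose = (z : ℂ) • P := by
    ext i j
    simp only [P, Matrix.transpose_apply, Matrix.of_apply, Matrix.smul_apply, smul_eq_mul]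
    by_cases h : j = Fin.rev i
    · subst h
      rw [if_pos (Fin.rev_rev i).symm, if_pos rfl, ← hsign (Fin.rev i), Fin.rev_rev]
    · have h' : i ≠ Fin.rev j := fun h'' => h (by rw [h'', Fin.rev_rev])
      simp [h, h']
  have hPS : P * S = -(S.transpose * P) := by
    ext i j
    have hl : (P * S) i j = (-1) ^ (i : ℕ) * S (Fin.rev i) j := by
      simp [P, Matrix.mul_apply]
    have hr : (S.transpose * P) i j = S (Fin.rev j) i * (-1) ^ (Fin.rev j : ℕ) := by
      simp [P, Matrix.mul_apply, ← Fin.rev_eq_iff]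
    rw [Matrix.neg_apply, hl, hr]
    simp only [S, jordanBlock, Matrix.of_apply]
    by_cases h : (i : ℕ) + j = k
    · have h1 : (Fin.rev i : ℕ) + 1 = j := by rw [Fin.val_rev]; omega
      have h2 : (Fin.rev j : ℕ) + 1 = i := by rw [Fin.val_rev]; omega
      rw [if_pos h1, if_pos h2, if_neg fun h' => by rw [h'] at h1; omega,
        if_neg fun h' => by rw [h'] at h2; omega, ← h2, pow_succ]
      simp only [mul_one, one_mul, mul_neg]
    · have h1 : (Fin.rev i : ℕ) + 1 ≠ j := by rw [Fin.val_rev]; omega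
      have h2 : (Fin.rev j : ℕ) + 1 ≠ i := by rw [Fin.val_rev]; omega
      simp only [h1, h2, if_false, ite_self, mul_zero, zero_mul, neg_zero]
  have hPu : IsUnit P := by
    refine IsUnit.of_mul_eq_one P.transpose ?_
    ext i j
    simp only [P, Matrix.mul_apply, Matrix.one_apply, Matrix.transpose_apply, Matrix.of_apply,
      ite_mul, zero_mul, Finset.sum_ite_eq', Finset.mem_univ, if_true, Fin.rev_inj]
    split_ifs with h
    · rw [h, ← mul_pow]
      simp
    · simp
  have hnil : IsNilpotent S := by
    obtain ⟨m, hm⟩ := isNilpotent_jordanBlock_sub k 0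
    refine ⟨m, (Matrix.toLinAlgEquiv' (R := ℂ) (n := Fin k)).injective ?_⟩
    rw [map_pow, map_zero, ← hm, map_zero, sub_zero]
    rfl
  have hU : IsUnit (1 - S) := hnil.isUnit_one_sub
  set U := 1 - S with hUdef
  have hUU : U * U⁻¹ = 1 := Matrix.mul_nonsing_inv _ ((Matrix.isUnit_iff_isUnit_det _).1 hU)
  have hUU' : U⁻¹ * U = 1 := Matrix.nonsing_inv_mul _ ((Matrix.isUnit_iff_isUnit_det _).1 hU)
  have hUS : Commute U S := (Commute.one_left S).sub_left (Commute.refl S)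
  have hU' : Commute U (1 + S) := (Commute.one_right U).add_right hUS
  set T := (z : ℂ) • (U⁻¹ * (1 + S)) with hT
  have hUT : U * T = (z : ℂ) • (1 + S) := by
    rw [hT, Matrix.mul_smul, ← mul_assoc, hUU, one_mul]
  have hcomm : Commute U T := by
    rw [Commute, SemiconjBy, hUT, hT, Matrix.smul_mul, mul_assoc, ← hU'.eq, ← mul_assoc, hUU',
      one_mul]
  have hz0 : (2 * z : ℂ) ≠ 0 := mul_ne_zero two_ne_zero z.ne_zero
  have hTS : U * (T - algebraMap ℂ (Matrix (Fin k) (Fin k) ℂ) z) =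
      (2 * z : ℂ) • (S - algebraMap ℂ (Matrix (Fin k) (Fin k) ℂ) 0) := by
    rw [mul_sub, hUT, map_zero, sub_zero, Algebra.algebraMap_eq_smul_one, Matrix.mul_smul, mul_one,
      ← smul_sub, hUdef, mul_comm, mul_smul, two_smul]
    congr 1
    abel
  refine ⟨Fin k, inferInstance, inferInstance, P * U, T, hPu.mul hU, ?_, fun w j => ?_⟩
  · rw [mul_assoc, hUT, Matrix.transpose_mul, hPt, hUdef, Matrix.transpose_sub,
      Matrix.transpose_one, Matrix.mul_smul, Matrix.mul_smul, sub_mul, one_mul, mul_add, mul_one,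
      hPS, sub_eq_add_neg]
  · rw [nul_block]
    split_ifs with h
    · subst h
      rw [nullity_of_mul_eq hU hz0 hTS hcomm, nullity_jordanBlock, if_pos rfl]
    · refine nullity_eq_zero_of_isNilpotent (z := z) ?_ (fun h' => h (Units.ext h')) j
      have hT0 : IsNilpotent (T - algebraMap ℂ (Matrix (Fin k) (Fin k) ℂ) z) := by
        have h1 : T - algebraMap ℂ (Matrix (Fin k) (Fin k) ℂ) z = U⁻¹ * ((2 * z : ℂ) • S) := by
          rw [map_zero, sub_zero] at hTS
          rw [← hTS, ← mul_assoc, hUU', one_mul]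
        rw [h1]
        refine Commute.isNilpotent_mul_left ?_ (hnil.smul _)
        refine Commute.smul_right ?_ _
        calc U⁻¹ * S = U⁻¹ * (S * U) * U⁻¹ := by rw [mul_assoc, mul_assoc, hUU, mul_one]
          _ = S * U⁻¹ := by rw [← hUS.eq, ← mul_assoc, hUU', one_mul]
      obtain ⟨m, hm⟩ := hT0
      refine ⟨m, ?_⟩
      have h2 := congrArg (Matrix.toLinAlgEquiv' (R := ℂ) (n := Fin k)) hm
      rwa [map_pow, map_sub, map_zero, AlgEquiv.commutes] at h2

theorem isAdmissible_pair (z : ℂˣ) (k : ℕ+) : (block z k + block z⁻¹ k).IsAdmissible := by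
  have h0 : ((-1 : ℂˣ))⁻¹ = -1 := by simp
  refine ⟨fun w => ?_, fun l _ => ?_, fun l _ => ?_⟩
  · ext l
    simp only [Finsupp.add_apply, block_apply, inv_inj, inv_eq_iff_eq_inv (a := z) (b := w)]
    rw [add_comm]
  · simp only [Finsupp.add_apply, block_apply, inv_eq_one]
    exact ⟨_, rfl⟩
  · simp only [Finsupp.add_apply, block_apply, inv_eq_iff_eq_inv, h0]
    exact ⟨_, rfl⟩

theorem isAdmissible_block {z : ℂˣ} {k : ℕ+}
    (h : z = 1 ∧ Odd (k : ℕ) ∨ z = -1 ∧ Even (k : ℕ)) : (block z k).IsAdmissible := by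
  have h0 : z⁻¹ = z := by
    obtain ⟨rfl, -⟩ | ⟨rfl, -⟩ := h <;> simp
  have h1 : (1 : ℂˣ) ≠ -1 := fun h => by
    have := congrArg Units.val h
    norm_num [Complex.ext_iff] at this
  refine ⟨fun w => ?_, fun l hl => ?_, fun l hl => ?_⟩
  · ext l
    simp only [block_apply, ← inv_eq_iff_eq_inv, h0]
  · rw [block_apply, if_neg]
    · simp
    · rintro ⟨rfl, rfl⟩
      obtain ⟨-, h⟩ | ⟨h, -⟩ := h
      · exact (Nat.not_even_iff_odd.2 h) hl
      · exact h1 h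
  · rw [block_apply, if_neg]
    · simp
    · rintro ⟨rfl, rfl⟩
      obtain ⟨h, -⟩ | ⟨-, h⟩ := h
      · exact h1 h.symm
      · exact (Nat.not_even_iff_odd.2 hl) h

theorem IsAdmissible.of_add {μ ν : MultiplicityFunction} (h : (μ + ν).IsAdmissible)
    (hν : ν.IsAdmissible) : μ.IsAdmissible := by
  refine ⟨fun z => ?_, fun k hk => ?_, fun k hk => ?_⟩
  · have h1 := h.symm z
    rw [Finsupp.add_apply, Finsupp.add_apply, ← hν.symm z] at h1
    exact add_right_cancel h1
  · exact (Nat.even_add.1 (h.even_one k hk)).2 (hν.even_one k hk)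
  · exact (Nat.even_add.1 (h.even_neg_one k hk)).2 (hν.even_neg_one k hk)

/-- Splitting off one admissible building block at a time: a single block of size `k` with
eigenvalue `(-1) ^ (k - 1)`, or else a pair of blocks with inverse eigenvalues. -/
theorem IsAdmissible.realizable {μ : MultiplicityFunction} (h : μ.IsAdmissible) :
    μ.Realizable := by
  induction μ using WellFoundedLT.induction with
  | _ μ ih =>
    have step {β : MultiplicityFunction} (hle : ∀ z k, β z k ≤ μ z k) (h0 : β ≠ 0)
        (hβ : β.IsAdmissible) (hr : β.Realizable) : μ.Realizable := by
      have hle : β ≤ μ := fun z k => hle z k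
      have hμ : μ - β + β = μ := tsub_add_cancel_of_le hle
      rw [← hμ] at h ⊢
      refine (ih _ ?_ (h.of_add hβ)).add hr
      conv_rhs => rw [← hμ]
      exact lt_add_of_pos_right _ (pos_iff_ne_zero.2 h0)
    by_cases hμ : μ = 0
    · rw [hμ]
      exact realizable_zero
    obtain ⟨z, hz⟩ := Finsupp.ne_iff.1 hμ
    obtain ⟨k, hk⟩ := Finsupp.ne_iff.1 hz
    have hb : block z k z k = 1 := by simp [block_apply]
    by_cases hc : z = 1 ∧ Odd (k : ℕ) ∨ z = -1 ∧ Even (k : ℕ)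
    · refine step (β := block z k) (fun w l => ?_) ?_ (isAdmissible_block hc) (realizable_block ?_)
      · rw [block_apply]
        split_ifs with hwl
        · obtain ⟨rfl, rfl⟩ := hwl
          exact Nat.one_le_iff_ne_zero.2 hk
        · exact Nat.zero_le _
      · intro h0
        rw [h0] at hb
        simp at hb
      · have hkp := k.pos
        obtain ⟨rfl, hko⟩ | ⟨rfl, hko⟩ := hc
        · rw [(Nat.Odd.sub_odd hko odd_one).neg_one_pow, Units.val_one]
        · rw [(Nat.Even.sub_odd hkp hko odd_one).neg_one_pow]
          simp
    · refine step (β := block z k + block z⁻¹ k) (fun w l => ?_) ?_ (isAdmissible_pair z k)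
        (realizable_pair z k)
      · have hk : μ z k ≠ 0 := hk
        have hk' : μ z⁻¹ k = μ z k := by rw [← h.symm z]
        -- for `z = ±1` the two blocks of the pair coincide, and the parity condition provides both
        have h2 : z⁻¹ = z → 2 ≤ μ z k := by
          intro hzz
          have he : Even (μ z k) := by
            rcases Units.inv_eq_self_iff z |>.1 hzz with rfl | rfl
            · exact h.even_one k (by simpa using hc)
            · exact h.even_neg_one k (by simpa using hc)
          obtain ⟨m, hm⟩ := he
          omega
        simp only [Finsupp.add_apply, block_apply]
        by_cases h3 : z = w ∧ k = l
        · obtain ⟨rfl, rfl⟩ := h3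
          by_cases h4 : z⁻¹ = z
          · simpa [h4] using h2 h4
          · simp [h4]; omega
        · by_cases h4 : z⁻¹ = w ∧ k = l
          · obtain ⟨rfl, rfl⟩ := h4
            rw [if_neg h3, hk']
            simp; omega
          · simp [h3, h4]
      · intro h0
        have h1 : (block z k + block z⁻¹ k) z k = 0 := by rw [h0]; rfl
        rw [Finsupp.add_apply, Finsupp.add_apply, hb] at h1
        omega

end MultiplicityFunction

/-! ### The classification -/

namespace MultiplicityFunction

theorem Realizable.exists_theta {μ : MultiplicityFunction} (h : μ.Realizable) :
    ∃ (N : ℕ) (E : Matrix (Fin N) (Fin N) ℂ), IsUnit E ∧ μ.IsMultiplicityOf (Θ E) := by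
  obtain ⟨ι, _, _, E, T, hE, hT, h⟩ := h
  let e : ι ≃ Fin (Fintype.card ι) := Fintype.equivFin ι
  have hEe : IsUnit (E.submatrix e.symm e.symm) := (Matrix.isUnit_submatrix_equiv _ _).2 hE
  have hΘ : Θ (E.submatrix e.symm e.symm) = T.submatrix e.symm e.symm := by
    rw [Θ, Matrix.transpose_submatrix, ← hT, ← Matrix.submatrix_mul_equiv E T e.symm e.symm e.symm,
      Matrix.nonsing_inv_mul_cancel_left _ _ ((Matrix.isUnit_iff_isUnit_det _).1 hEe)]
  refine ⟨_, _, hEe, ?_⟩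
  obtain ⟨ν, hν⟩ := exists_isMultiplicityOf (isUnit_theta hEe)
  convert hν
  refine ext_nul fun z j => ?_
  rw [← hν.nullity_eq, ← h, hΘ]
  refine nullity_congr (LinearEquiv.funCongrLeft ℂ ℂ e.symm) (fun v => ?_) _ _
  ext i
  simp only [Matrix.toLin'_apply, Matrix.mulVec, dotProduct, Matrix.submatrix_apply,
    LinearEquiv.funCongrLeft_apply, LinearMap.funLeft_apply]
  exact Equiv.sum_comp e.symm fun l => T (e.symm i) l * v l

end MultiplicityFunction

namespace FiberFunctor

variable {d : ℂ} {F G : FiberFunctor d} {N : ℕ}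

theorem formMatrix_eq_gram (b : Module.Basis (Fin N) ℂ F.V) : F.formMatrix b = F.gram b := rfl

theorem formMatrix_apply (b : Module.Basis (Fin N) ℂ F.V) (i j : Fin N) :
    F.formMatrix b i j = F.form (b i ⊗ₜ[ℂ] b j) := rfl

theorem formMatrix_map {φ : F.V ≃ₗ[ℂ] G.V}
    (h : ∀ x y, G.form (φ x ⊗ₜ[ℂ] φ y) = F.form (x ⊗ₜ[ℂ] y)) (b : Module.Basis (Fin N) ℂ F.V) :
    G.formMatrix (b.map φ) = F.formMatrix b := by
  ext i j
  simp only [formMatrix_apply, Module.Basis.map_apply]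
  exact h _ _

theorem form_eq_sum (b : Module.Basis (Fin N) ℂ F.V) (x y : F.V) :
    F.form (x ⊗ₜ[ℂ] y) = ∑ i, ∑ j, b.repr x i * F.formMatrix b i j * b.repr y j := by
  conv_lhs => rw [← b.sum_repr x, ← b.sum_repr y]
  simp only [TensorProduct.sum_tmul, TensorProduct.tmul_sum, TensorProduct.smul_tmul_smul,
    map_sum, map_smul, formMatrix_apply, smul_eq_mul]
  rw [Finset.sum_comm]
  refine Finset.sum_congr rfl fun i _ => Finset.sum_congr rfl fun j _ => ?_
  ring

theorem formMatrix_eq_congruence (b c : Module.Basis (Fin N) ℂ F.V) :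
    F.formMatrix c = (b.toMatrix c).transpose * F.formMatrix b * b.toMatrix c := by
  ext i j
  rw [formMatrix_apply, form_eq_sum b]
  simp only [Matrix.mul_apply, Matrix.transpose_apply, Finset.sum_mul, Module.Basis.toMatrix_apply]
  exact Finset.sum_comm

theorem isUnit_formMatrix (b : Module.Basis (Fin N) ℂ F.V) : IsUnit (F.formMatrix b) :=
  F.isUnit_gram b

theorem isMultiplicityOf_basis_change {μ : MultiplicityFunction} {M : ℕ}
    {b : Module.Basis (Fin N) ℂ F.V} (h : μ.IsMultiplicityOf (Θ (F.formMatrix b)))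
    (c : Module.Basis (Fin M) ℂ F.V) : μ.IsMultiplicityOf (Θ (F.formMatrix c)) := by
  obtain rfl : N = M := by
    simpa using (Module.finrank_eq_card_basis b).symm.trans (Module.finrank_eq_card_basis c)
  have hS : IsUnit (b.toMatrix c) := .of_mul_eq_one _ (b.toMatrix_mul_toMatrix_flip c)
  refine h.of_similar hS ?_
  rw [formMatrix_eq_congruence b c]
  exact mul_inv_mul_transpose_congruence hS

theorem exists_isMultiplicityOf_formMatrix (F : FiberFunctor d) : ∃ μ : MultiplicityFunction,
    ∀ (N : ℕ) (b : Module.Basis (Fin N) ℂ F.V), μ.IsMultiplicityOf (Θ (F.formMatrix b)) := by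
  obtain ⟨μ, hμ⟩ := exists_isMultiplicityOf
    (isUnit_theta (F.isUnit_formMatrix (Module.finBasis ℂ F.V)))
  exact ⟨μ, fun N b => isMultiplicityOf_basis_change hμ b⟩

/-- The multiplicity function of `Θ(E)`, where `E` is the matrix of `F(ε)` in any basis. -/
noncomputable def multiplicity (F : FiberFunctor d) : MultiplicityFunction :=
  F.exists_isMultiplicityOf_formMatrix.choose

theorem isMultiplicityOf_multiplicity (F : FiberFunctor d) (b : Module.Basis (Fin N) ℂ F.V) :
    F.multiplicity.IsMultiplicityOf (Θ (F.formMatrix b)) :=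
  F.exists_isMultiplicityOf_formMatrix.choose_spec N b

theorem isAdmissible_multiplicity (F : FiberFunctor d) : F.multiplicity.IsAdmissible :=
  isAdmissible_of_isMultiplicityOf (F.isUnit_formMatrix _)
    (F.isMultiplicityOf_multiplicity (Module.finBasis ℂ F.V))

theorem trace_multiplicity (F : FiberFunctor d) : F.multiplicity.trace = d := by
  rw [← (F.isMultiplicityOf_multiplicity (Module.finBasis ℂ F.V)).trace_eq]
  exact F.trace_inv_gram_mul_transpose _

/-- The multiplicity function is a complete invariant of fiber functors. -/
theorem equiv_iff_multiplicity_eq : F ≈ G ↔ F.multiplicity = G.multiplicity := by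
  constructor
  · intro h
    obtain ⟨φ, hφ⟩ := exists_isometry h
    let b := Module.finBasis ℂ F.V
    refine (F.isMultiplicityOf_multiplicity b).unique ?_
    rw [← formMatrix_map hφ]
    exact G.isMultiplicityOf_multiplicity _
  · intro h
    let b := Module.finBasis ℂ F.V
    have hF := F.isMultiplicityOf_multiplicity b
    have hG := G.isMultiplicityOf_multiplicity (Module.finBasis ℂ G.V)
    have hN : Module.finrank ℂ G.V = Module.finrank ℂ F.V := by
      rw [← hF.card_eq, ← hG.card_eq, h]
    let c : Module.Basis (Fin (Module.finrank ℂ F.V)) ℂ G.V := Module.finBasisOfFinrankEq ℂ G.V hN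
    have hc := G.isMultiplicityOf_multiplicity c
    rw [← h] at hc
    obtain ⟨S, hS, hSΘ⟩ := hc.exists_similar hF
    obtain ⟨B, hB, hE⟩ := exists_congruence_of_theta_similar (G.isUnit_formMatrix c)
      (F.isUnit_formMatrix b) hS hSΘ
    let c' := c.map (Matrix.toLinearEquiv c B ((Matrix.isUnit_iff_isUnit_det _).1 hB))
    have hB' : c.toMatrix c' = B := by
      ext i j
      simp [Module.Basis.toMatrix_apply, c', Matrix.toLin_self, Finsupp.single_apply]
    have hc' : G.formMatrix c' = F.formMatrix b := by
      rw [hE, formMatrix_eq_congruence c c', hB']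
    have hφ : G.form ∘ₗ TensorProduct.map (b.equiv c' (Equiv.refl _)).toLinearMap
        (b.equiv c' (Equiv.refl _)).toLinearMap = F.form :=
      (b.tensorProduct b).ext fun ⟨i, j⟩ => by
        simpa [formMatrix_apply] using congrFun₂ hc' i j
    exact equiv_of_isometry (b.equiv c' (Equiv.refl _)) fun x y => LinearMap.congr_fun hφ (x ⊗ₜ y)

theorem exists_multiplicity_eq {μ : MultiplicityFunction} (h : μ.IsAdmissible)
    (hd : μ.trace = d) : ∃ F : FiberFunctor d, F.multiplicity = μ := by
  obtain ⟨N, E, hE, hμ⟩ := h.realizable.exists_theta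
  obtain ⟨F, b, hF⟩ := exists_gram_eq hE (hμ.trace_eq.trans hd)
  refine ⟨F, (F.isMultiplicityOf_multiplicity b).unique ?_⟩
  rwa [formMatrix_eq_gram, hF]

end FiberFunctor

/-- The bijection sending the class of a fiber functor `F` to its multiplicity function. -/
noncomputable def classification (d : ℂ) : FiberFunctor.IsoClass d ≃
    {μ : MultiplicityFunction // μ.IsAdmissible ∧ d = μ.trace} :=
  Equiv.ofBijective
    (Quotient.lift (fun F : FiberFunctor d =>
      ⟨F.multiplicity, F.isAdmissible_multiplicity, F.trace_multiplicity.symm⟩)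
      fun _ _ h => Subtype.ext (FiberFunctor.equiv_iff_multiplicity_eq.1 h))
    ⟨fun x y => Quotient.inductionOn₂ x y fun _ _ h =>
        Quotient.sound (FiberFunctor.equiv_iff_multiplicity_eq.2 (congrArg Subtype.val h)),
      fun ⟨_, hμ, hd⟩ =>
        let ⟨F, hF⟩ := FiberFunctor.exists_multiplicity_eq hμ hd.symm
        ⟨F.isoClass, Subtype.ext hF⟩⟩

end TemperleyLieb

theorem theorem2p2 (d : ℂ) (hd : d ≠ 0) :
    ∃ Φ : TemperleyLieb.FiberFunctor.IsoClass d ≃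
        {μ : TemperleyLieb.MultiplicityFunction // μ.IsAdmissible ∧ d = μ.trace},
      ∀ (F : TemperleyLieb.FiberFunctor d) (N : ℕ) (b : Module.Basis (Fin N) ℂ F.V),
        IsUnit (F.formMatrix b) ∧
          (Φ F.isoClass).1.IsMultiplicityOf (TemperleyLieb.Θ (F.formMatrix b)) :=
  ⟨TemperleyLieb.classification d, fun F _ b =>
    ⟨F.isUnit_formMatrix b, F.isMultiplicityOf_multiplicity b⟩⟩
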